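/- Setting. Let $d=d_1+d_2\ge1$ with $d_1,d_2\in\mathbb N_0$, and let $E(n)$ and $O(n)$ be the Euclidean and the orthogonal group of $\mathbb R^n$. Write $\mathrm{rot}(g)\in O(d)$ for the linear component of $g\in E(d)$, and for $A\in O(d_1)$, $h\in E(d_2)$ let $A\oplus h\in E(d)$ be $(x_1,x_2)\mapsto(Ax_1,h\cdot x_2)$. Let $\mathcal G<E(d)$ be a non-trivial discrete group (every orbit is discrete) contained in $\{A\oplus h: A\in O(d_1),\,h\in\mathcal S\}$ whose image under $\pi:A\oplus h\mapsto h$ is $\mathcal S$, where $\mathcal S<E(d_2)$ is a space group (a discrete group containing $d_2$ translations with linearly independent translation vectors). Let $x_0\in\mathbb R^d$ be such that $g\mapsto g\cdot x_0$ is injective on $\mathcal G$. Fix a set $\mathcal T\subset\mathcal G$ that $\pi$ maps bijectively onto the set of translations in $\mathcal S$; put $\mathcal T^N=\{t^N:t\in\mathcal T\}$, and let $M$ be the set of all integers $N\ge1$ for which $\mathcal T^N$ is a normal subgroup of $\mathcal G$ (it then has finite index). A function $u$ on $\mathcal G$ is $\mathcal T^N$-periodic if $u(gt)=u(g)$ for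 all $g\in\mathcal G$, $t\in\mathcal T^N$. Let $U_{\mathrm{per}}$ be the space of all $u:\mathcal G\to\mathbb R^d$ that are $\mathcal T^N$-periodic for some $N\in M$, with the uniform norm, and let $\mathcal C_N$ be a set of representatives of $\mathcal G/\mathcal T^N$. Energy. Let $V:(\mathbb R^d)^{\mathcal G\setminus\{id\}}\to\mathbb R$ satisfy: $V(Ay)=V(y)$ for all $A\in O(d)$ and all $y$; for every $y$ the map $z\mapsto V(y+z)$ on $L^\infty(\mathcal G\setminus\{id\},\mathbb R^d)$ is twice continuously Fréchet differentiable; and $V$ has finite interaction range, i.e. there is a finite set $\mathcal R_V\subset\mathcal G\setminus\{id\}$ with $V(y)=V(\chi_{\mathcal R_V}y)$ for all $y$. For $w\in U_{\mathrm{per}}$ that is $\mathcal T^N$-periodic, $N\in M$, set $$E(w)=\frac1{|\mathcal C_N|}\sum_{g\in\mathcal C_N}V\Big(\big((gh)\cdot w(gh)-g\cdot w(g)\big)_{h\in\mathcal G\setminus\{id\}}\Big).$$ The identity deformation is the constant function $w\equiv x_0$; $E''$ below denotes the second Fréchet derivative of $E:U_{\mathrm{per}}\to\mathbb R$ (with respect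 to the uniform norm) at this point. Seminorm. Let $\mathcal R\subset\mathcal G$ be a finite set for which there are $\mathcal R',\mathcal R''\subset\mathcal G$ such that $id\in\mathcal R'$, $\mathcal R'$ generates $\mathcal G$, $\mathcal R''$ is finite, $id\in\mathcal R''$, $\mathcal R''\cdot x_0$ and $\mathcal G\cdot x_0$ have the same affine hull, and $\mathcal R'\mathcal R''\subset\mathcal R$. Let $U_{\mathrm{iso},0,0}(\mathcal R)$ be the space of all $v:\mathcal R\to\mathbb R^d$ for which there are $a\in\mathbb R^d$ and a skew-symmetric $S_1\in\mathbb R^{d_1\times d_1}$ with $\mathrm{rot}(g)v(g)=a+(S_1\oplus0_{d_2,d_2})(g\cdot x_0-x_0)$ for all $g\in\mathcal R$. Let $\pi_{\mathcal R}$ be the orthogonal projection of $(\mathbb R^d)^{\mathcal R}$ (with the Euclidean norm) with kernel $U_{\mathrm{iso},0,0}(\mathcal R)$. For $\mathcal T^N$-periodic $u\in U_{\mathrm{per}}$, $N\in M$, set $$\|u\|_{\mathcal R,0,0}=\Big(\frac1{|\mathcal C_N|}\sum_{g\in\mathcal C_N}\big\|\pi_{\mathcal R}\big(u(g\,\cdot)|_{\mathcal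 R}\big)\big\|^2\Big)^{1/2},$$ and define $$\lambda_{\mathrm a,0,0}=\sup\{c\in\mathbb R:\ c\,\|u\|_{\mathcal R,0,0}^2\le E''(u,u)\ \text{ for all }u\in U_{\mathrm{per}}\}\in[-\infty,\infty].$$ Theorem. Suppose that $d=1+d_2$. Then $E$ is Fréchet differentiable near, and twice Fréchet differentiable at, the identity deformation, and the bilinear form $E''$ is bounded with respect to $\|\cdot\|_{\mathcal R,0,0}$: there is a constant $C>0$ such that $|E''(u,v)|\le C\,\|u\|_{\mathcal R,0,0}\,\|v\|_{\mathcal R,0,0}$ for all $u,v\in U_{\mathrm{per}}$. In particular $\lambda_{\mathrm a,0,0}\in\mathbb R$. -/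

import Mathlib

open scoped ENNReal Topology

noncomputable section

namespace ObjStr

/-! ### Euclidean isometries -/

/-- The coordinate space `ℝⁿ` with its Euclidean norm. -/
abbrev Vec (n : ℕ) : Type := EuclideanSpace ℝ (Fin n)

/-- The Euclidean space `ℝ^d = ℝ^{d₁} × ℝ^{d₂}`, where `d = d₁ + d₂`. -/
abbrev Space (d₁ d₂ : ℕ) : Type := WithLp 2 (Vec d₁ × Vec d₂)

/-- The group of Euclidean isometries of `X`. -/
abbrev Euc (X : Type) [NormedAddCommGroup X] [InnerProductSpace ℝ X] : Type := X ≃ᵃⁱ[ℝ] X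

/-- The orthogonal group of `X`. -/
abbrev Orth (X : Type) [NormedAddCommGroup X] [InnerProductSpace ℝ X] : Type := X ≃ₗᵢ[ℝ] X

section Euclidean

variable {X : Type} [NormedAddCommGroup X] [InnerProductSpace ℝ X]

/-- The linear component of a Euclidean isometry, so that `g x = rot g x + g 0`. -/
def rot (g : Euc X) : Orth X := g.linearIsometryEquiv

/-- A subgroup of the Euclidean group is discrete if each of its orbits is a discrete set. -/
def IsDiscreteGroup (G : Subgroup (Euc X)) : Prop :=
  ∀ x : X, DiscreteTopology (Set.range fun g : G => (g : Euc X) x)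

end Euclidean

/-- The translation of `ℝⁿ` by `b`. -/
def translation {n : ℕ} (b : Vec n) : Euc (Vec n) := AffineIsometryEquiv.constVAdd ℝ (Vec n) b

/-- A space group in dimension `n`: a discrete group of isometries of `ℝⁿ` that contains `n`
translations whose translation vectors are linearly independent. -/
def IsSpaceGroup {n : ℕ} (S : Subgroup (Euc (Vec n))) : Prop :=
  IsDiscreteGroup S ∧
    ∃ b : Fin n → Vec n, LinearIndependent ℝ b ∧ ∀ i, translation (b i) ∈ S

/-- The isometry `A ⊕ h : (x₁, x₂) ↦ (A x₁, h x₂)` of `ℝ^{d₁} × ℝ^{d₂}`. -/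
def gplusFun {d₁ d₂ : ℕ} (A : Orth (Vec d₁)) (h : Euc (Vec d₂)) : Euc (Space d₁ d₂) :=
  AffineIsometryEquiv.mk' (fun x => WithLp.toLp 2 (A x.fst, h x.snd))
    (A.withLpProdCongr 2 (rot h)) 0 (by
      intro p
      have hh : h p.snd = rot h p.snd + h 0 := by
        have := h.map_vadd 0 p.snd
        simpa [rot] using this
      apply (WithLp.equiv 2 (Vec d₁ × Vec d₂)).injective
      ext1 <;> simp [hh])

@[simp] lemma gplusFun_apply {d₁ d₂ : ℕ} (A : Orth (Vec d₁)) (h : Euc (Vec d₂))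
    (x : Space d₁ d₂) : gplusFun A h x = WithLp.toLp 2 (A x.fst, h x.snd) := rfl

/-- The group homomorphism `⊕ : O(d₁) × E(d₂) → E(d₁ + d₂)`. -/
def gplus (d₁ d₂ : ℕ) : Orth (Vec d₁) × Euc (Vec d₂) →* Euc (Space d₁ d₂) where
  toFun p := gplusFun p.1 p.2
  map_one' := by ext x : 1; rfl
  map_mul' p q := by ext x : 1; rfl

/-- The projection of `G ∩ (O(d₁) ⊕ E(d₂))` to `E(d₂)`. -/
def projGroup {d₁ d₂ : ℕ} (G : Subgroup (Euc (Space d₁ d₂))) : Subgroup (Euc (Vec d₂)) :=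
  (G.comap (gplus d₁ d₂)).map (MonoidHom.snd _ _)

/-- `T ⊆ G` is a section of the translation group of `projGroup G`: the projection
`A ⊕ h ↦ h` maps `T` bijectively to the set of all translations in `projGroup G`. -/
def IsTransSection {d₁ d₂ : ℕ} (G : Subgroup (Euc (Space d₁ d₂))) (T : Set G) : Prop :=
  (∀ t ∈ T, ∃ (A : Orth (Vec d₁)) (b : Vec d₂), (t : Euc (Space d₁ d₂)) =
      gplus d₁ d₂ (A, translation b)) ∧
  ∀ b : Vec d₂, translation b ∈ projGroup G →
    ∃! t : G, t ∈ T ∧ ∃ A : Orth (Vec d₁), (t : Euc (Space d₁ d₂)) =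
      gplus d₁ d₂ (A, translation b)

/-- A discrete group `G < E(d)`, `d = d₁ + d₂`, contained in `O(d₁) ⊕ S` and projecting onto `S`,
where `S` is a `d₂`-dimensional space group, with a section `T` of the translations of `S` and
a point `x₀` at which the orbit map of `G` is injective. The associated objective structure is the
orbit of `x₀`. -/
structure ObjectiveStructure (d₁ d₂ : ℕ) where
  /-- the group -/
  G : Subgroup (Euc (Space d₁ d₂))
  discrete : IsDiscreteGroup G
  le_range : G ≤ (gplus d₁ d₂).range
  spaceGroup : IsSpaceGroup (projGroup G)
  /-- the section of the translation group of the space group -/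
  T : Set G
  isSection : IsTransSection G T
  /-- the base point -/
  x₀ : Space d₁ d₂
  injective : Function.Injective fun g : G => (g : Euc (Space d₁ d₂)) x₀

/-! ### The sets `T^N` and periodicity -/

section Periods

variable {Γ : Type*} [Group Γ]

/-- The subgroup generated by `T^N = {t^N : t ∈ T}`. -/
def powGroup (T : Set Γ) (N : ℕ) : Subgroup Γ := Subgroup.closure ((fun t => t ^ N) '' T)

/-- The set of all `N ≥ 1` for which `T^N = {t^N : t ∈ T}` is a normal subgroup. -/
def periods (T : Set Γ) : Set ℕ :=
  {N | 0 < N ∧ (powGroup T N : Set Γ) = (fun t => t ^ N) '' T ∧ (powGroup T N).Normal}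

/-- `u` is `T^N`-periodic. -/
def IsPeriodicWith {α : Type*} (T : Set Γ) (N : ℕ) (u : Γ → α) : Prop :=
  ∀ g : Γ, ∀ t ∈ T, u (g * t ^ N) = u g

/-- `u` is periodic. -/
def IsPeriodic {α : Type*} (T : Set Γ) (u : Γ → α) : Prop :=
  ∃ N ∈ periods T, IsPeriodicWith T N u

/-- The mean `|C_N|⁻¹ ∑_{g ∈ C_N} f g` over a representation set `C_N` of `Γ / T^N`. -/
def mean (T : Set Γ) (N : ℕ) (f : Γ → ℝ) : ℝ :=
  (∑ᶠ q : Γ ⧸ powGroup T N, f q.out) / (Nat.card (Γ ⧸ powGroup T N) : ℝ)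

/-- A periodic function is invariant under `T^(N * k)` if it is invariant under `T^N`. -/
lemma IsPeriodicWith.mul {α : Type*} {T : Set Γ} {N : ℕ} {u : Γ → α}
    (hu : IsPeriodicWith T N u) (k : ℕ) : IsPeriodicWith T (N * k) u := by
  intro g t ht
  rw [pow_mul]
  induction k generalizing g with
  | zero => simp
  | succ k ih => rw [pow_succ, ← mul_assoc, hu _ t ht, ih]

/-- If `φ` has finite kernel, `L` is normal and commutative, and `T` is a section over `L`, then
`T^N` is a normal subgroup for all multiples `N` of some `N₀ ≥ 1`. -/
lemma exists_periods {Q : Type*} [Group Q] (φ : Γ →* Q) (hker : Finite φ.ker) (L : Subgroup Q)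
    [hL : L.Normal] (hcomm : ∀ x ∈ L, ∀ y ∈ L, x * y = y * x) (T : Set Γ)
    (hT : ∀ t ∈ T, φ t ∈ L) (hT' : ∀ x, φ x ∈ L → ∃ t ∈ T, φ t = φ x) :
    ∃ N₀, 0 < N₀ ∧ ∀ k, 0 < k → N₀ * k ∈ periods T := by
  classical
  set F := φ.ker with hF
  have : Finite (MulAut F) := Finite.of_injective (fun e : MulAut F => (e : F → F))
    (fun a b h => by ext x; exact congrArg Subtype.val (congrFun h x))
  set a := Nat.card (MulAut F)
  set n := Nat.card F
  have ha : 0 < a := Nat.card_pos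
  have hn : 0 < n := Nat.card_pos
  have hcent : ∀ x : Γ, ∀ f ∈ F, Commute (x ^ a) f := by
    intro x f hf
    have h1 : (MulAut.conjNormal x : MulAut F) ^ a = 1 := pow_card_eq_one'
    rw [← map_pow] at h1
    have h2 := congrArg (fun e : MulAut F => ((e ⟨f, hf⟩ : F) : Γ)) h1
    simp only [MulAut.conjNormal_apply, MulAut.one_apply] at h2
    exact mul_inv_eq_iff_eq_mul.mp h2
  have hpow : ∀ f ∈ F, f ^ n = 1 := by
    intro f hf
    have : (⟨f, hf⟩ : F) ^ n = 1 := pow_card_eq_one'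
    exact congrArg Subtype.val this
  have key : ∀ p q : Γ, (∀ f ∈ F, Commute q f) → φ p = φ q → p ^ n = q ^ n := by
    intro p q hq h
    have hz : q⁻¹ * p ∈ F := by simp [hF, MonoidHom.mem_ker, h]
    have h1 : p = q * (q⁻¹ * p) := by group
    rw [h1, (hq _ hz).mul_pow, hpow _ hz, mul_one]
  have hcent' : ∀ (x : Γ) (m : ℕ), ∀ f ∈ F, Commute (x ^ (a * m)) f := by
    intro x m f hf
    rw [pow_mul]
    exact (hcent x f hf).pow_left m
  have same : ∀ x y : Γ, φ x = φ y → x ^ (a * n) = y ^ (a * n) := by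
    intro x y h
    rw [pow_mul, pow_mul]
    exact key _ _ (hcent y) (by simp [h])
  have hcm : ∀ x y : Γ, φ x ∈ L → φ y ∈ L → Commute (x ^ (a * n)) (y ^ (a * n)) := by
    intro x y hx hy
    have h1 : y ^ a * x ^ (a * n) * (y ^ a)⁻¹ = x ^ (a * n) := by
      rw [← conj_pow]
      apply same
      simp only [map_mul, map_inv, map_pow]
      rw [hcomm _ (pow_mem hy a) _ hx]; group
    have h2 : Commute (y ^ a) (x ^ (a * n)) := mul_inv_eq_iff_eq_mul.mp h1
    rw [pow_mul y]
    exact (h2.pow_left n).symm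
  have hmul : ∀ x y : Γ, φ x ∈ L → φ y ∈ L →
      x ^ (a * n * n) * y ^ (a * n * n) = (x * y) ^ (a * n * n) := by
    intro x y hx hy
    rw [pow_mul x, pow_mul y, pow_mul (x * y), ← (hcm x y hx hy).mul_pow]
    apply key
    · intro f hf
      exact hcent' (x * y) n f hf
    · have : Commute (φ x) (φ y) := hcomm _ hx _ hy
      simp only [map_mul, map_pow]
      rw [this.mul_pow]
  refine ⟨a * n * n, by positivity, fun k hk => ?_⟩
  have hset : (fun t => t ^ (a * n * n * k)) '' T =
      (fun t => t ^ (a * n * n * k)) '' {x | φ x ∈ L} := by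
    ext z
    constructor
    · rintro ⟨t, ht, rfl⟩
      exact ⟨t, hT t ht, rfl⟩
    · rintro ⟨x, hx, rfl⟩
      obtain ⟨t, ht, h⟩ := hT' x hx
      refine ⟨t, ht, ?_⟩
      have e : a * n * n * k = (a * n) * (n * k) := by ring
      simp only [e]
      rw [pow_mul, pow_mul x, same t x h]
  let H : Subgroup Γ :=
    { carrier := (fun t => t ^ (a * n * n * k)) '' {x | φ x ∈ L}
      one_mem' := ⟨1, by simp [L.one_mem], by simp⟩
      mul_mem' := by
        rintro _ _ ⟨x, hx, rfl⟩ ⟨y, hy, rfl⟩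
        refine ⟨x * y, by simpa using L.mul_mem hx hy, ?_⟩
        have hc : Commute (x ^ (a * n * n)) (y ^ (a * n * n)) := by
          rw [pow_mul x, pow_mul y]
          exact ((hcm x y hx hy).pow_left n).pow_right n
        simp only
        rw [pow_mul, pow_mul x, pow_mul y, ← hmul x y hx hy, hc.mul_pow]
      inv_mem' := by
        rintro _ ⟨x, hx, rfl⟩
        exact ⟨x⁻¹, by simpa using hx, by simp⟩ }
  have hcl : powGroup T (a * n * n * k) = H := by
    unfold powGroup
    rw [hset]
    exact H.closure_eq
  refine ⟨by positivity, ?_, ?_⟩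
  · rw [hset, hcl]; rfl
  · rw [hcl]
    refine ⟨?_⟩
    rintro _ ⟨x, hx, rfl⟩ g
    refine ⟨g * x * g⁻¹, ?_, by simp⟩
    simpa using hL.conj_mem _ hx (φ g)

end Periods

/-! ### Finiteness of the kernel of the projection -/

lemma gplus_injective (d₁ d₂ : ℕ) : Function.Injective (gplus d₁ d₂) := by
  rintro ⟨A, h⟩ ⟨B, k⟩ e
  have e' : ∀ x : Space d₁ d₂, gplus d₁ d₂ (A, h) x = gplus d₁ d₂ (B, k) x := fun x => by rw [e]
  refine Prod.ext ?_ ?_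
  · ext1 x
    exact congrArg WithLp.fst (e' (WithLp.toLp 2 (x, 0)))
  · ext1 x
    exact congrArg WithLp.snd (e' (WithLp.toLp 2 (0, x)))

/-- In a discrete group, a bounded part of an orbit is finite. -/
lemma IsDiscreteGroup.finite_inter {X : Type} [NormedAddCommGroup X] [InnerProductSpace ℝ X]
    [ProperSpace X] {G : Subgroup (Euc X)} (hG : IsDiscreteGroup G) (x : X) {K : Set X}
    (hK : Bornology.IsBounded K) :
    (K ∩ Set.range fun g : G => (g : Euc X) x).Finite := by
  set O := Set.range fun g : G => (g : Euc X) x with hO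
  have hd : DiscreteTopology O := hG x
  have hx : x ∈ O := ⟨1, by simp⟩
  obtain ⟨ε, hε, h⟩ := Metric.mem_nhds_iff.mp
    ((isOpen_discrete ({⟨x, hx⟩} : Set O)).mem_nhds (Set.mem_singleton _))
  refine Metric.finite_isBounded_inter_isClosed DiscreteTopology.isDiscrete hK
    (Metric.isClosed_of_pairwise_le_dist hε ?_)
  rintro _ ⟨g, rfl⟩ _ ⟨k, rfl⟩ hne
  by_contra! hlt
  have h1 : ((k⁻¹ * g : G) : Euc X) x ∈ O := ⟨k⁻¹ * g, rfl⟩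
  have h2 : (⟨_, h1⟩ : O) ∈ Metric.ball (⟨x, hx⟩ : O) ε := by
    rw [Metric.mem_ball, Subtype.dist_eq]
    have : dist ((k : Euc X) (((k⁻¹ * g : G) : Euc X) x)) ((k : Euc X) x) < ε := by
      have e : (k : Euc X) (((k⁻¹ * g : G) : Euc X) x) = (g : Euc X) x := by simp
      rw [e]; exact hlt
    simpa only [AffineIsometryEquiv.dist_map] using this
  have h3 : ((k⁻¹ * g : G) : Euc X) x = x := congrArg Subtype.val (h h2)
  apply hne
  have e : (k : Euc X) (((k⁻¹ * g : G) : Euc X) x) = (g : Euc X) x := by simp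
  simp only
  rw [← e, h3]

namespace ObjectiveStructure

variable {d₁ d₂ : ℕ} (𝒮 : ObjectiveStructure d₁ d₂)

/-- The inverse of `⊕` on `G`. -/
def split : 𝒮.G →* Orth (Vec d₁) × Euc (Vec d₂) :=
  (MonoidHom.ofInjective (gplus_injective d₁ d₂)).symm.toMonoidHom.comp
    (Subgroup.inclusion 𝒮.le_range)

lemma gplus_split (g : 𝒮.G) : gplus d₁ d₂ (𝒮.split g) = g := by
  have := (MonoidHom.ofInjective (gplus_injective d₁ d₂)).apply_symm_apply
    (Subgroup.inclusion 𝒮.le_range g)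
  exact congrArg Subtype.val this

/-- The projection `π : G → E(d₂)`. -/
def proj : 𝒮.G →* Euc (Vec d₂) := (MonoidHom.snd _ _).comp 𝒮.split

lemma finite_ker : Finite 𝒮.proj.ker := by
  let b := EuclideanSpace.basisFun (Fin d₁) ℝ
  let f : 𝒮.proj.ker → Fin d₁ → Space d₁ d₂ := fun g i =>
    ((g : 𝒮.G) : Euc (Space d₁ d₂)) (WithLp.toLp 2 (b i, 0))
  have hval : ∀ g : 𝒮.proj.ker, ∀ x : Space d₁ d₂, ((g : 𝒮.G) : Euc (Space d₁ d₂)) x =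
      WithLp.toLp 2 ((𝒮.split g).1 x.fst, x.snd) := by
    intro g x
    have h1 : (𝒮.split g).2 = 1 := g.2
    rw [← 𝒮.gplus_split g]
    change WithLp.toLp 2 (_, (𝒮.split g).2 x.snd) = _
    rw [h1]; rfl
  have hfin : ∀ i, (Set.range fun g => f g i).Finite := by
    intro i
    refine (𝒮.discrete.finite_inter (WithLp.toLp 2 (b i, 0))
      (Metric.isBounded_closedBall (x := (0 : Space d₁ d₂))
        (r := ‖(WithLp.toLp 2 (b i, 0) : Space d₁ d₂)‖))).subset ?_
    rintro _ ⟨g, rfl⟩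
    refine ⟨?_, ⟨g, rfl⟩⟩
    simp only [f, mem_closedBall_zero_iff]
    rw [hval, WithLp.prod_norm_eq_of_L2, WithLp.prod_norm_eq_of_L2]
    simp
  have hfin' : (Set.range f).Finite := by
    refine (Set.Finite.pi' hfin).subset ?_
    rintro _ ⟨g, rfl⟩ i
    exact ⟨g, rfl⟩
  have hinj : Function.Injective f := by
    intro g k hgk
    apply Subtype.ext
    apply Subtype.ext
    have hA : (𝒮.split g).1 = (𝒮.split k).1 := by
      apply LinearIsometryEquiv.toLinearEquiv_injective
      apply LinearEquiv.toLinearMap_injective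
      apply b.toBasis.ext
      intro i
      have := congrArg WithLp.fst (congrFun hgk i)
      simp only [f, hval] at this
      simpa using this
    ext1 x
    rw [hval, hval, hA]
  have : Finite (Set.range f) := hfin'
  exact Finite.of_injective (Set.rangeFactorization f)
    (Set.rangeFactorization_injective.mpr hinj)

/-- There is `N₀ ≥ 1` such that `T^N` is a normal subgroup of `G` for all multiples `N` of `N₀`. -/
lemma exists_periods : ∃ N₀, 0 < N₀ ∧ ∀ k, 0 < k → N₀ * k ∈ periods 𝒮.T := by
  let lin : Euc (Vec d₂) →* Orth (Vec d₂) :=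
    { toFun := rot
      map_one' := rfl
      map_mul' := fun _ _ => rfl }
  have hker : ∀ h ∈ lin.ker, ∃ b, h = translation b := by
    intro h hh
    refine ⟨h 0, ?_⟩
    have h1 : h.linearIsometryEquiv = 1 := hh
    ext1 x
    have h2 := h.map_vadd 0 x
    rw [h1] at h2
    simpa [translation, add_comm] using h2
  have hker' : ∀ b, translation b ∈ lin.ker := by
    intro b
    change (translation b).linearIsometryEquiv = 1
    ext1 x
    have h2 := (translation b).map_vsub x 0
    simpa [translation] using h2
  have hpT : ∀ (g : 𝒮.G) A h, (g : Euc (Space d₁ d₂)) = gplus d₁ d₂ (A, h) → 𝒮.proj g = h := by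
    intro g A h e
    have : 𝒮.split g = (A, h) := gplus_injective d₁ d₂ (by rw [𝒮.gplus_split, e])
    change (𝒮.split g).2 = h
    rw [this]
  refine ObjStr.exists_periods 𝒮.proj 𝒮.finite_ker lin.ker ?_ 𝒮.T ?_ ?_
  · intro x hx y hy
    obtain ⟨b, rfl⟩ := hker x hx
    obtain ⟨c, rfl⟩ := hker y hy
    ext1 z
    simp [translation, add_left_comm]
  · intro t ht
    obtain ⟨A, b, h⟩ := 𝒮.isSection.1 t ht
    rw [hpT t A _ h]
    exact hker' b
  · intro g hg
    obtain ⟨b, hb⟩ := hker _ hg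
    have hmem : translation b ∈ projGroup 𝒮.G := by
      rw [← hb]
      refine ⟨𝒮.split g, ?_, rfl⟩
      change gplus d₁ d₂ (𝒮.split g) ∈ 𝒮.G
      rw [𝒮.gplus_split]; exact g.2
    obtain ⟨t, ⟨ht, A, h⟩, -⟩ := 𝒮.isSection.2 b hmem
    exact ⟨t, ht, by rw [hb, hpT t A _ h]⟩

/-- Two periods have a common multiple that is a period. -/
lemma exists_common_period {N₁ N₂ : ℕ} (h₁ : 0 < N₁) (h₂ : 0 < N₂) :
    ∃ k₁ k₂, N₁ * k₁ = N₂ * k₂ ∧ N₁ * k₁ ∈ periods 𝒮.T := by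
  obtain ⟨N₀, h₀, h⟩ := 𝒮.exists_periods
  refine ⟨N₀ * N₂, N₀ * N₁, by ring, ?_⟩
  have e : N₁ * (N₀ * N₂) = N₀ * (N₁ * N₂) := by ring
  rw [e]
  exact h _ (by positivity)

/-! ### Displacements, energy and its second derivative -/

/-- The space `U_per` of periodic functions `u : G → ℝ^d` with the uniform norm. (Since `T^N` has
finite index in `G`, periodic functions are bounded.) -/
def UPer : Submodule ℝ (lp (fun _ : 𝒮.G => Space d₁ d₂) ∞) where
  carrier := {u | IsPeriodic 𝒮.T (u : 𝒮.G → Space d₁ d₂)}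
  zero_mem' := by
    obtain ⟨N₀, h₀, h⟩ := 𝒮.exists_periods
    exact ⟨N₀ * 1, h 1 one_pos, fun g t _ => rfl⟩
  add_mem' := by
    rintro u v ⟨N₁, hN₁, h₁⟩ ⟨N₂, hN₂, h₂⟩
    obtain ⟨k₁, k₂, e, hk⟩ := 𝒮.exists_common_period hN₁.1 hN₂.1
    refine ⟨N₁ * k₁, hk, fun g t ht => ?_⟩
    have e₁ := h₁.mul k₁ g t ht
    have e₂ := h₂.mul k₂ g t ht
    rw [← e] at e₂
    simp only [lp.coeFn_add, Pi.add_apply, e₁, e₂]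
  smul_mem' := by
    rintro c u ⟨N, hN, h⟩
    refine ⟨N, hN, fun g t ht => ?_⟩
    simp only [lp.coeFn_smul, Pi.smul_apply, h g t ht]

/-- The value at `g ∈ G` of `u ∈ U_per`. -/
def val (u : 𝒮.UPer) (g : 𝒮.G) : Space d₁ d₂ :=
  (u : lp (fun _ : 𝒮.G => Space d₁ d₂) ∞) g

/-- A number `N` for which `T^N` is a normal subgroup and `u` is `T^N`-periodic. -/
def period (u : 𝒮.UPer) : ℕ := Exists.choose u.2

/-- The constant function `x₀`, which corresponds to the identity deformation. -/
def identity : 𝒮.UPer :=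
  ⟨⟨fun _ => 𝒮.x₀, memℓp_infty ⟨‖𝒮.x₀‖, by rintro _ ⟨g, rfl⟩; exact le_rfl⟩⟩, by
    obtain ⟨N₀, h₀, h⟩ := 𝒮.exists_periods
    exact ⟨N₀ * 1, h 1 one_pos, fun g t _ => rfl⟩⟩

/-- `G \ {id}`. -/
abbrev Punctured : Type := {h : 𝒮.G // h ≠ 1}

/-- Interaction potentials: invariance under `O(d)`, twice continuous Fréchet differentiability in
the direction of bounded perturbations, and finite interaction range. -/
structure IsPotential (V : (𝒮.Punctured → Space d₁ d₂) → ℝ) : Prop where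
  invariant : ∀ (A : Orth (Space d₁ d₂)) (y : 𝒮.Punctured → Space d₁ d₂),
    V (fun h => A (y h)) = V y
  smooth : ∀ y : 𝒮.Punctured → Space d₁ d₂,
    ContDiff ℝ 2 fun z : lp (fun _ : 𝒮.Punctured => Space d₁ d₂) ∞ => V (fun h => y h + z h)
  finiteRange : ∃ RV : Set 𝒮.Punctured, RV.Finite ∧
    ∀ y : 𝒮.Punctured → Space d₁ d₂, V y = V (RV.indicator y)

/-- The configurational energy
`E w = |C_N|⁻¹ ∑_{g ∈ C_N} V (((g h) · w (g h) - g · w g)_h)` for `T^N`-periodic `w`. -/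
def energy (V : (𝒮.Punctured → Space d₁ d₂) → ℝ) (w : 𝒮.UPer) : ℝ :=
  mean 𝒮.T (𝒮.period w) fun g =>
    V fun h => ((g * h.1 : 𝒮.G) : Euc (Space d₁ d₂)) (𝒮.val w (g * h.1))
      - (g : Euc (Space d₁ d₂)) (𝒮.val w g)

/-- The second Fréchet derivative `E''` of the energy at the identity deformation. -/
def energyHess (V : (𝒮.Punctured → Space d₁ d₂) → ℝ) : 𝒮.UPer →L[ℝ] 𝒮.UPer →L[ℝ] ℝ :=
  fderiv ℝ (fderiv ℝ (𝒮.energy V)) 𝒮.identity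

/-! ### The seminorm -/

/-- Property 1: `R` is finite, contains the identity, and `R · x₀` and `G · x₀` have the same affine
hull. -/
def HasProperty1 (R : Set 𝒮.G) : Prop :=
  R.Finite ∧ 1 ∈ R ∧
    affineSpan ℝ ((fun g : 𝒮.G => (g : Euc (Space d₁ d₂)) 𝒮.x₀) '' R) =
      affineSpan ℝ (Set.range fun g : 𝒮.G => (g : Euc (Space d₁ d₂)) 𝒮.x₀)

/-- Property 2: `R` is finite and contains `R' R''` for a generating set `R'` of `G` that contains
the identity and a set `R''` with Property 1. -/
def HasProperty2 (R : Set 𝒮.G) : Prop :=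
  R.Finite ∧ ∃ R' R'' : Set 𝒮.G, 1 ∈ R' ∧ Subgroup.closure R' = ⊤ ∧ 𝒮.HasProperty1 R'' ∧
    ∀ r' ∈ R', ∀ r'' ∈ R'', r' * r'' ∈ R

variable (R : Finset 𝒮.G)

/-- The Euclidean space of all functions `R → ℝ^d`. -/
abbrev LocalField : Type := PiLp 2 fun _ : R => Space d₁ d₂

/-- The space `U_trans(R)` of infinitesimal translations. -/
def UTrans : Submodule ℝ (𝒮.LocalField R) where
  carrier := {u | ∃ a : Space d₁ d₂, ∀ g : R, rot (g.1 : Euc (Space d₁ d₂)) (u g) = a}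
  zero_mem' := ⟨0, fun g => by simp⟩
  add_mem' := by
    rintro u v ⟨a, ha⟩ ⟨b, hb⟩
    exact ⟨a + b, fun g => by simp [ha, hb]⟩
  smul_mem' := by
    rintro c u ⟨a, ha⟩
    exact ⟨c • a, fun g => by simp [ha]⟩

/-- The linear map `S₁ ⊕ 0 : (x₁, x₂) ↦ (S₁ x₁, 0)`. -/
def blockMap (S₁ : Matrix (Fin d₁) (Fin d₁) ℝ) (x : Space d₁ d₂) : Space d₁ d₂ :=
  WithLp.toLp 2 (Matrix.toEuclideanLin S₁ x.fst, 0)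

/-- The space `U_{rot,0,0}(R)` of infinitesimal rotations with linear component `S₁ ⊕ 0`, where `S₁`
is a skew symmetric `d₁ × d₁` matrix. -/
def URot00 : Submodule ℝ (𝒮.LocalField R) where
  carrier := {u | ∃ S₁ : Matrix (Fin d₁) (Fin d₁) ℝ, S₁.transpose = -S₁ ∧
    ∀ g : R, rot (g.1 : Euc (Space d₁ d₂)) (u g) =
      blockMap S₁ ((g.1 : Euc (Space d₁ d₂)) 𝒮.x₀ - 𝒮.x₀)}
  zero_mem' := ⟨0, by simp, fun g => by simp [blockMap]; rfl⟩
  add_mem' := by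
    rintro u v ⟨A, hA, ha⟩ ⟨B, hB, hb⟩
    refine ⟨A + B, by rw [Matrix.transpose_add, hA, hB, neg_add], fun g => ?_⟩
    simp only [PiLp.add_apply, map_add, ha, hb]
    simp [blockMap, ← WithLp.toLp_add]
  smul_mem' := by
    rintro c u ⟨A, hA, ha⟩
    refine ⟨c • A, by rw [Matrix.transpose_smul, hA, smul_neg], fun g => ?_⟩
    simp only [PiLp.smul_apply, map_smul, ha]
    simp [blockMap, ← WithLp.toLp_smul]

/-- `U_{iso,0,0}(R) = U_trans(R) + U_{rot,0,0}(R)`. -/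
def UIso00 : Submodule ℝ (𝒮.LocalField R) := 𝒮.UTrans R ⊔ 𝒮.URot00 R

/-- The restriction `u(g ·)|_R`. -/
def restrict (u : 𝒮.UPer) (g : 𝒮.G) : 𝒮.LocalField R :=
  WithLp.toLp 2 fun h => 𝒮.val u (g * h.1)

/-- The seminorm `‖u‖_{R,0,0} = (|C_N|⁻¹ ∑_{g ∈ C_N} ‖π(u(g ·)|_R)‖²)^{1/2}` for `T^N`-periodic `u`,
where `π` is the orthogonal projection with kernel `U_{iso,0,0}(R)`. -/
def seminorm00 (u : 𝒮.UPer) : ℝ :=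
  Real.sqrt (mean 𝒮.T (𝒮.period u) fun g =>
    ‖(𝒮.UIso00 R)ᗮ.starProjection (𝒮.restrict R u g)‖ ^ 2)

/-- The stability constant `λ_{a,0,0}`, an extended real number. -/
def lambda00 (V : (𝒮.Punctured → Space d₁ d₂) → ℝ) : EReal :=
  sSup ((fun c : ℝ => (c : EReal)) ''
    {c : ℝ | ∀ u : 𝒮.UPer, c * 𝒮.seminorm00 R u ^ 2 ≤ 𝒮.energyHess V u u})

end ObjectiveStructure

/-- A bilinear form `B` is bounded with respect to the seminorm `p`. -/
def BoundedWrt {W : Type*} (B : W → W → ℝ) (p : W → ℝ) : Prop :=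
  ∃ C : ℝ, 0 < C ∧ ∀ v w, |B v w| ≤ C * p v * p w

end ObjStr

end

noncomputable section

namespace ObjStr

/-! ### Coset sums and means of periodic functions. -/

section Periods

variable {Γ : Type*} [Group Γ] {T : Set Γ} {N M : ℕ} {α β : Type*}

/-! By invariance of `V` under the linear part of `g`, the energy contribution at `g` depends on `w`
only through the strain `h ↦ rot(h) u(gh) - u(g)` of `u = w - x₀`. Hence `E` is the average over `g`
of a fixed C² function `F` of strains that are linear in `u` and bounded by `2‖u‖` uniformly in `g`.
This uniformity lets Taylor estimates for `F` near `0` pass to the average. They give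
differentiability, and `E''(u,v)` is the average of `F''(0)` at the strains of `u` and `v`.

Finite range means that `F''(0)` sees only finitely many components of the strain. By Cauchy-Schwarz
it remains to bound, for each fixed `h`, the mean square of the strain in direction `h` by the
squared seminorm. For `d₁ = 1` a skew-symmetric `S₁` is zero, so the projection in the seminorm
removes only translations, which have zero strain; this gives the bound for the generators in `R`
(`norm_diff_sq_le_localSq`). The strain obeys the cocycle identity `diff_mul`, and averages are
invariant under right multiplication, so the bound passes to products and inverses, hence to all of
`G` (`exists_msd_le`).

The boundedness puts `λ` between `-C` and `C` once the seminorm is nonzero somewhere. A vanishing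
seminorm makes all strains vanish, which fails for a nonzero vector times the indicator of a proper
subgroup `T^N`. Such a subgroup exists because a non-trivial `G` cannot consist of arbitrarily high
powers of elements of `T` (`exists_powGroup_ne_top`). -/

lemma IsPeriodicWith.mul_mem {u : Γ → α} (hu : IsPeriodicWith T N u) (hN : N ∈ periods T)
    (g : Γ) {s : Γ} (hs : s ∈ powGroup T N) : u (g * s) = u g := by
  have hs' : s ∈ (powGroup T N : Set Γ) := hs
  rw [hN.2.1] at hs'
  obtain ⟨t, ht, rfl⟩ := hs'
  exact hu g t ht

lemma IsPeriodicWith.of_mul_mem {u : Γ → α}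
    (hu : ∀ g, ∀ s ∈ powGroup T N, u (g * s) = u g) : IsPeriodicWith T N u :=
  fun g t ht => hu g _ (Subgroup.subset_closure ⟨t, ht, rfl⟩)

lemma IsPeriodicWith.apply_out {u : Γ → α} (hu : IsPeriodicWith T N u) (hN : N ∈ periods T)
    (g : Γ) : u (g : Γ ⧸ powGroup T N).out = u g := by
  obtain ⟨s, hs⟩ := QuotientGroup.mk_out_eq_mul (powGroup T N) g
  rw [hs, hu.mul_mem hN g s.2]

lemma IsPeriodicWith.comp {u : Γ → α} (hu : IsPeriodicWith T N u) (φ : α → β) :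
    IsPeriodicWith T N fun g => φ (u g) := fun g t ht => congrArg φ (hu g t ht)

lemma IsPeriodicWith.prodMk {u : Γ → α} {v : Γ → β} (hu : IsPeriodicWith T N u)
    (hv : IsPeriodicWith T N v) : IsPeriodicWith T N fun g => (u g, v g) :=
  fun g t ht => Prod.ext (hu g t ht) (hv g t ht)

/-- Normality is what makes this work: `s` can be moved past `h` as `h⁻¹ s h`. -/
lemma IsPeriodicWith.mul_right {u : Γ → α} (hu : IsPeriodicWith T N u) (hN : N ∈ periods T)
    (h : Γ) : IsPeriodicWith T N fun g => u (g * h) := by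
  refine .of_mul_mem fun g s hs => ?_
  have h1 : g * s * h = g * h * (h⁻¹ * s * h) := by group
  have h2 : h⁻¹ * s * h ∈ powGroup T N := by
    simpa using hN.2.2.conj_mem s hs h⁻¹
  simp only [h1, hu.mul_mem hN _ h2]

lemma mean_eq_sum [Fintype (Γ ⧸ powGroup T N)] (f : Γ → ℝ) :
    mean T N f = (∑ q : Γ ⧸ powGroup T N, f q.out) / (Fintype.card (Γ ⧸ powGroup T N) : ℝ) := by
  rw [mean, finsum_eq_sum_of_fintype, Nat.card_eq_fintype_card]

/-- Multiplication by the class of `h` permutes the quotient group, and periodicity makes the choice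
of representatives irrelevant. -/
lemma sum_out_mul_right [Fintype (Γ ⧸ powGroup T N)] (hN : N ∈ periods T) {f : Γ → ℝ}
    (hf : IsPeriodicWith T N f) (h : Γ) :
    ∑ q : Γ ⧸ powGroup T N, f (q.out * h) = ∑ q : Γ ⧸ powGroup T N, f q.out := by
  have := hN.2.2
  rw [← Equiv.sum_comp (Equiv.mulRight (h : Γ ⧸ powGroup T N)) fun q => f q.out]
  refine Finset.sum_congr rfl fun q _ => ?_
  rw [← hf.apply_out hN]
  congr 2
  simp

lemma sum_out_mul_left [Fintype (Γ ⧸ powGroup T N)] (hN : N ∈ periods T) {f : Γ → ℝ}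
    (hf : IsPeriodicWith T N f) (h : Γ) :
    ∑ q : Γ ⧸ powGroup T N, f (h * q.out) = ∑ q : Γ ⧸ powGroup T N, f q.out := by
  have := hN.2.2
  rw [← Equiv.sum_comp (Equiv.mulLeft (h : Γ ⧸ powGroup T N)) fun q => f q.out]
  refine Finset.sum_congr rfl fun q _ => ?_
  rw [← hf.apply_out hN]
  congr 2
  simp

/-- The mean of a periodic function does not depend on the choice of the period. -/
lemma mean_eq_mean [Finite (Γ ⧸ powGroup T N)] [Finite (Γ ⧸ powGroup T M)]
    (hN : N ∈ periods T) (hM : M ∈ periods T) {f : Γ → ℝ}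
    (hfN : IsPeriodicWith T N f) (hfM : IsPeriodicWith T M f) : mean T N f = mean T M f := by
  have := Fintype.ofFinite (Γ ⧸ powGroup T N)
  have := Fintype.ofFinite (Γ ⧸ powGroup T M)
  -- No common period is needed: left invariance evaluates the inner sum over `b`, right invariance
  -- the inner sum over `a`, and each outer sum contributes only an index.
  have e : ∑ a : Γ ⧸ powGroup T N, ∑ b : Γ ⧸ powGroup T M, f (a.out * b.out) =
      ∑ b : Γ ⧸ powGroup T M, ∑ a : Γ ⧸ powGroup T N, f (a.out * b.out) := Finset.sum_comm
  simp only [sum_out_mul_left hM hfM, sum_out_mul_right hN hfN, Finset.sum_const,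
    Finset.card_univ, nsmul_eq_mul] at e
  rw [mean_eq_sum, mean_eq_sum, div_eq_div_iff (by simp) (by simp)]
  linarith

end Periods

/-! ### Translation vectors and the finite index of `T^N`. -/

lemma translation_apply {n : ℕ} (b x : Vec n) : translation b x = b + x := rfl

lemma translation_add {n : ℕ} (b c : Vec n) :
    translation (b + c) = translation b * translation c := by
  ext1 x
  change b + c + x = b + (c + x)
  abel

lemma translation_nsmul {n : ℕ} (b : Vec n) (k : ℕ) :
    translation (k • b) = translation b ^ k := by
  induction k with
  | zero => ext1 x; simp [translation_apply]
  | succ k ih => rw [succ_nsmul, translation_add, ih, pow_succ]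

/-- The vectors of the translations in a group of isometries. -/
def transVectors {n : ℕ} (S : Subgroup (Euc (Vec n))) : AddSubgroup (Vec n) where
  carrier := {b | translation b ∈ S}
  zero_mem' := by
    have : translation (0 : Vec n) = 1 := by ext1 x; simp [translation_apply]
    simp [this]
  add_mem' {b c} hb hc := by
    simp only [Set.mem_ofPred_eq, translation_add] at *
    exact S.mul_mem hb hc
  neg_mem' {b} hb := by
    have : translation (-b) = (translation b)⁻¹ := by
      rw [eq_inv_iff_mul_eq_one, ← translation_add]
      ext1 x; simp [translation_apply]
    simp only [Set.mem_ofPred_eq, this] at *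
    exact S.inv_mem hb

lemma rot_apply_sub {X : Type} [NormedAddCommGroup X] [InnerProductSpace ℝ X] (g : Euc X)
    (x y : X) : rot g (x - y) = g x - g y := by
  simpa [rot] using g.map_vsub x y

namespace ObjectiveStructure

variable {d₁ d₂ : ℕ} (𝒮 : ObjectiveStructure d₁ d₂)

lemma coe_apply (g : 𝒮.G) (x : Space d₁ d₂) :
    (g : Euc (Space d₁ d₂)) x = WithLp.toLp 2 ((𝒮.split g).1 x.fst, 𝒮.proj g x.snd) := by
  conv_lhs => rw [← 𝒮.gplus_split g]
  rfl

lemma proj_mem (g : 𝒮.G) : 𝒮.proj g ∈ projGroup 𝒮.G := by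
  refine ⟨𝒮.split g, ?_, rfl⟩
  change gplus d₁ d₂ (𝒮.split g) ∈ 𝒮.G
  rw [𝒮.gplus_split]; exact g.2

lemma proj_eq {g : 𝒮.G} {A : Orth (Vec d₁)} {h : Euc (Vec d₂)}
    (e : (g : Euc (Space d₁ d₂)) = gplus d₁ d₂ (A, h)) : 𝒮.proj g = h := by
  have : 𝒮.split g = (A, h) := gplus_injective d₁ d₂ (by rw [𝒮.gplus_split, e])
  change (𝒮.split g).2 = h
  rw [this]

lemma exists_mem_T {b : Vec d₂} (hb : b ∈ transVectors (projGroup 𝒮.G)) :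
    ∃ t ∈ 𝒮.T, 𝒮.proj t = translation b := by
  obtain ⟨t, ⟨ht, A, h⟩, -⟩ := 𝒮.isSection.2 b hb
  exact ⟨t, ht, 𝒮.proj_eq h⟩

lemma proj_of_mem_T {t : 𝒮.G} (ht : t ∈ 𝒮.T) :
    ∃ b ∈ transVectors (projGroup 𝒮.G), 𝒮.proj t = translation b := by
  obtain ⟨A, b, h⟩ := 𝒮.isSection.1 t ht
  have := 𝒮.proj_mem t
  rw [𝒮.proj_eq h] at this
  exact ⟨b, this, 𝒮.proj_eq h⟩

/-- Elements of `G` that move the origin by a bounded amount form a finite set. -/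
lemma finite_proj_le (r : ℝ) : {g : 𝒮.G | ‖𝒮.proj g 0‖ ≤ r}.Finite := by
  -- Injectivity of the orbit map at `x₀` turns finiteness of a bounded part of the orbit into
  -- finiteness of a set of group elements.
  have hfin := 𝒮.discrete.finite_inter 𝒮.x₀
    (Metric.isBounded_closedBall (x := (0 : Space d₁ d₂)) (r := ‖𝒮.x₀‖ + r))
  refine (hfin.preimage (f := fun g : 𝒮.G => (g : Euc (Space d₁ d₂)) 𝒮.x₀)
    𝒮.injective.injOn).subset fun g hg => ⟨?_, g, rfl⟩
  rw [Set.mem_ofPred_eq] at hg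
  have h1 : ‖(g : Euc (Space d₁ d₂)) 0‖ = ‖𝒮.proj g 0‖ := by
    rw [𝒮.coe_apply, WithLp.prod_norm_eq_of_L2]
    simp
  have h2 : ‖(g : Euc (Space d₁ d₂)) 𝒮.x₀ - (g : Euc (Space d₁ d₂)) 0‖ = ‖𝒮.x₀‖ := by
    rw [← rot_apply_sub]; simp
  rw [mem_closedBall_zero_iff]
  calc _ = ‖((g : Euc (Space d₁ d₂)) 𝒮.x₀ - (g : Euc (Space d₁ d₂)) 0)
        + (g : Euc (Space d₁ d₂)) 0‖ := by simp
    _ ≤ _ := (norm_add_le _ _).trans (by rw [h1, h2]; gcongr)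

/-- Every vector is within bounded distance of the `N`-th multiple of a translation vector. -/
lemma exists_transVector_near (N : ℕ) (hN : 0 < N) : ∃ r : ℝ, ∀ x : Vec d₂,
    ∃ b ∈ transVectors (projGroup 𝒮.G), ‖N • b - x‖ ≤ r := by
  obtain ⟨-, b, hb, hbS⟩ := 𝒮.spaceGroup
  let B := basisOfLinearIndependentOfCardEqFinrank' b hb (by simp)
  have hB : ∀ i, B i = b i := by simp [B]
  refine ⟨∑ i, (N : ℝ) * ‖b i‖, fun x => ?_⟩
  -- Round the coordinates of `x / N` down; multiplied by `N`, the error in direction `b i` is at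
  -- most `N`, whence the radius above.
  refine ⟨∑ i, ⌊B.repr x i / N⌋ • b i, ?_, ?_⟩
  · exact sum_mem fun i _ => zsmul_mem (show b i ∈ transVectors (projGroup 𝒮.G) from hbS i) _
  · have hx : x = ∑ i, B.repr x i • b i := by
      conv_lhs => rw [← B.sum_repr x]
      simp [hB]
    have h1 : N • ∑ i, ⌊B.repr x i / N⌋ • b i - x =
        ∑ i, ((N : ℝ) * ⌊B.repr x i / N⌋ - B.repr x i) • b i := by
      conv_lhs => rw [hx]
      simp only [sub_smul, Finset.sum_sub_distrib, mul_smul, ← Finset.smul_sum]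
      simp only [← hx, Nat.cast_smul_eq_nsmul, Int.cast_smul_eq_zsmul]
    rw [h1]
    refine (norm_sum_le _ _).trans (Finset.sum_le_sum fun i _ => ?_)
    rw [norm_smul]
    gcongr
    have hN' : (0 : ℝ) < N := by exact_mod_cast hN
    have h2 : (N : ℝ) * ⌊B.repr x i / N⌋ - B.repr x i = - (N * Int.fract (B.repr x i / N)) := by
      rw [Int.fract]; field_simp; ring
    rw [h2, norm_neg, Real.norm_eq_abs, abs_of_nonneg (by positivity)]
    nlinarith [Int.fract_lt_one (B.repr x i / N)]

/-- `T^N` has finite index in `G`. -/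
lemma finite_quotient {N : ℕ} (hN : 0 < N) : Finite (𝒮.G ⧸ powGroup 𝒮.T N) := by
  obtain ⟨r, hr⟩ := 𝒮.exists_transVector_near N hN
  have : Finite {g : 𝒮.G | ‖𝒮.proj g 0‖ ≤ r} := 𝒮.finite_proj_le r
  refine Finite.of_surjective
    (fun g : {g : 𝒮.G | ‖𝒮.proj g 0‖ ≤ r} => (g.1 : 𝒮.G ⧸ powGroup 𝒮.T N)) fun q => ?_
  induction q using QuotientGroup.induction_on with | _ g =>
  -- Since `proj g` is an isometry taking `(proj g)⁻¹ 0` to `0`, moving the origin near that point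
  -- first makes `g t^N` displace it by at most `r`. So every coset meets a finite set.
  obtain ⟨b, hb, hbr⟩ := hr ((𝒮.proj g)⁻¹ 0)
  obtain ⟨t, ht, htb⟩ := 𝒮.exists_mem_T hb
  refine ⟨⟨g * t ^ N, ?_⟩, ?_⟩
  · rw [Set.mem_ofPred_eq, map_mul, map_pow, htb, ← translation_nsmul]
    have h1 : (𝒮.proj g) ((𝒮.proj g)⁻¹ 0) = 0 := (𝒮.proj g).apply_symm_apply 0
    change ‖𝒮.proj g (N • b + 0)‖ ≤ r
    have h2 := rot_apply_sub (𝒮.proj g) (N • b + 0) ((𝒮.proj g)⁻¹ 0)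
    rw [h1, sub_zero] at h2
    rw [← h2, LinearIsometryEquiv.norm_map, add_zero]
    exact hbr
  · rw [eq_comm, QuotientGroup.eq]
    have : t ^ N ∈ powGroup 𝒮.T N := Subgroup.subset_closure ⟨t, ht, rfl⟩
    simpa using this

/-- In a non-trivial group `G`, some subgroup `T^N` is proper. -/
lemma exists_powGroup_ne_top (hG : 𝒮.G ≠ ⊥) : ∃ N ∈ periods 𝒮.T, powGroup 𝒮.T N ≠ ⊤ := by
  by_contra! hall
  obtain ⟨N₀, h₀, hper⟩ := 𝒮.exists_periods
  -- If no `T^N` is proper, every element is an arbitrarily high power of an element of `T`.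
  have hroot : ∀ g : 𝒮.G, ∀ k : ℕ, ∃ t ∈ 𝒮.T, t ^ (N₀ * (k + 1)) = g := by
    intro g k
    have h1 : g ∈ (powGroup 𝒮.T (N₀ * (k + 1)) : Set 𝒮.G) := by
      rw [hall _ (hper _ k.succ_pos)]; trivial
    rw [(hper _ k.succ_pos).2.1] at h1
    exact h1
  -- Then each translation vector `b` can be divided by every `N₀ (k + 1)`. The quotients tend to
  -- `0` inside a discrete orbit, so some quotient is `0`, and `b = 0`.
  have hz : ∀ b ∈ transVectors (projGroup 𝒮.G), b = 0 := by
    intro b hb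
    obtain ⟨s, -, hs⟩ := 𝒮.exists_mem_T hb
    have hdiv : ∀ k : ℕ, ((N₀ * (k + 1) : ℕ) : ℝ)⁻¹ • b ∈ transVectors (projGroup 𝒮.G) := by
      intro k
      obtain ⟨t, ht, e⟩ := hroot s k
      obtain ⟨c, hc, htc⟩ := 𝒮.proj_of_mem_T ht
      have h1 : translation b = translation ((N₀ * (k + 1)) • c) := by
        rw [translation_nsmul, ← htc, ← map_pow, e, hs]
      have h2 : b = (N₀ * (k + 1)) • c := by
        have := congrArg (fun f : Euc (Vec d₂) => f 0) h1
        simpa [translation_apply] using this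
      have hne : ((N₀ * (k + 1) : ℕ) : ℝ) ≠ 0 := by positivity
      rw [h2, ← Nat.cast_smul_eq_nsmul ℝ, smul_smul, inv_mul_cancel₀ hne, one_smul]
      exact hc
    set O := Set.range fun g : projGroup 𝒮.G => (g : Euc (Vec d₂)) 0
    have hd : DiscreteTopology O := 𝒮.spaceGroup.1 0
    have hO : ∀ c ∈ transVectors (projGroup 𝒮.G), c ∈ O := fun c hc =>
      ⟨⟨translation c, hc⟩, by simp [translation_apply]⟩
    have h0 : (0 : Vec d₂) ∈ O := hO 0 (zero_mem _)
    have hlim : Filter.Tendsto (fun k : ℕ => ((N₀ * (k + 1) : ℕ) : ℝ)⁻¹ • b) Filter.atTop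
        (𝓝 0) := by
      rw [← zero_smul ℝ b]
      refine Filter.Tendsto.smul_const (tendsto_inv_atTop_zero.comp
        (tendsto_natCast_atTop_atTop.comp ?_)) b
      refine Filter.tendsto_atTop_mono (fun k => ?_) Filter.tendsto_id
      simp only [id]
      nlinarith
    have hlim' : Filter.Tendsto (fun k : ℕ => (⟨_, hO _ (hdiv k)⟩ : O)) Filter.atTop
        (𝓝 ⟨0, h0⟩) := tendsto_subtype_rng.mpr hlim
    rw [nhds_discrete, Filter.tendsto_pure] at hlim'
    obtain ⟨k, hk⟩ := hlim'.exists
    have h3 := congrArg Subtype.val hk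
    have hne : ((N₀ * (k + 1) : ℕ) : ℝ) ≠ 0 := by positivity
    simpa [hne, h₀.ne', Nat.cast_add_one_ne_zero] using h3
  apply hG
  rw [Subgroup.eq_bot_iff_forall]
  -- Without non-zero translation vectors `T` has at most one element `t`, and every element of `G`,
  -- including `1`, equals `t ^ N₀`.
  have huniq : ∀ t ∈ 𝒮.T, ∀ t' ∈ 𝒮.T, t = t' := by
    intro t ht t' ht'
    obtain ⟨A, b, h⟩ := 𝒮.isSection.1 t ht
    obtain ⟨A', b', h'⟩ := 𝒮.isSection.1 t' ht'
    have hb : b ∈ transVectors (projGroup 𝒮.G) := by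
      have := 𝒮.proj_mem t; rwa [𝒮.proj_eq h] at this
    have hb' : b' ∈ transVectors (projGroup 𝒮.G) := by
      have := 𝒮.proj_mem t'; rwa [𝒮.proj_eq h'] at this
    obtain rfl := (hz b hb).trans (hz b' hb').symm
    exact (𝒮.isSection.2 b hb).unique ⟨ht, A, h⟩ ⟨ht', A', h'⟩
  intro x hx
  obtain ⟨t, ht, e⟩ := hroot ⟨x, hx⟩ 0
  obtain ⟨t', ht', e'⟩ := hroot 1 0
  rw [huniq t ht t' ht', e'] at e
  exact (congrArg Subtype.val e).symm

end ObjectiveStructure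

/-! ### Averages of periodic functions. -/

lemma IsPeriodic.comp {Γ α β : Type*} [Group Γ] {T : Set Γ} {u : Γ → α} (hu : IsPeriodic T u)
    (φ : α → β) : IsPeriodic T fun g => φ (u g) :=
  let ⟨N, hN, h⟩ := hu
  ⟨N, hN, h.comp φ⟩

lemma IsPeriodic.mul_right {Γ α : Type*} [Group Γ] {T : Set Γ} {u : Γ → α}
    (hu : IsPeriodic T u) (x : Γ) : IsPeriodic T fun g => u (g * x) :=
  let ⟨N, hN, h⟩ := hu
  ⟨N, hN, h.mul_right hN x⟩

namespace ObjectiveStructure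

variable {d₁ d₂ : ℕ} {𝒮 : ObjectiveStructure d₁ d₂} {α β : Type*}

lemma isPeriodic_prodMk {u : 𝒮.G → α} {v : 𝒮.G → β} (hu : IsPeriodic 𝒮.T u)
    (hv : IsPeriodic 𝒮.T v) : IsPeriodic 𝒮.T fun g => (u g, v g) := by
  obtain ⟨N₁, hN₁, h₁⟩ := hu
  obtain ⟨N₂, hN₂, h₂⟩ := hv
  obtain ⟨k₁, k₂, e, hk⟩ := 𝒮.exists_common_period hN₁.1 hN₂.1
  exact ⟨N₁ * k₁, hk, (h₁.mul k₁).prodMk (e ▸ h₂.mul k₂)⟩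

lemma finite_range_of_isPeriodic {u : 𝒮.G → α} (hu : IsPeriodic 𝒮.T u) :
    (Set.range u).Finite := by
  obtain ⟨N, hN, h⟩ := hu
  have := 𝒮.finite_quotient hN.1
  refine (Set.finite_range fun q : 𝒮.G ⧸ powGroup 𝒮.T N => u q.out).subset ?_
  rintro _ ⟨g, rfl⟩
  exact ⟨g, h.apply_out hN g⟩

open Classical in
/-- The mean of a periodic function with respect to any of its periods. -/
def avg (f : 𝒮.G → ℝ) : ℝ := if h : IsPeriodic 𝒮.T f then mean 𝒮.T h.choose f else 0

lemma avg_eq {N : ℕ} (hN : N ∈ periods 𝒮.T) {f : 𝒮.G → ℝ} (hf : IsPeriodicWith 𝒮.T N f) :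
    avg f = mean 𝒮.T N f := by
  have h : IsPeriodic 𝒮.T f := ⟨N, hN, hf⟩
  rw [avg, dif_pos h]
  have := 𝒮.finite_quotient hN.1
  have := 𝒮.finite_quotient h.choose_spec.1.1
  exact mean_eq_mean h.choose_spec.1 hN h.choose_spec.2 hf

/-- The sample points `s` do not depend on `φ`. Bundling several periodic functions into one
tuple-valued `u` therefore reduces relations between their averages to finite sums over the same
points. -/
lemma exists_avg_eq {u : 𝒮.G → α} (hu : IsPeriodic 𝒮.T u) : ∃ (ι : Type) (_ : Fintype ι)
    (_ : Nonempty ι) (s : ι → 𝒮.G), (∀ g, ∃ i, u (s i) = u g) ∧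
      ∀ φ : α → ℝ, avg (fun g => φ (u g)) = (∑ i, φ (u (s i))) / Fintype.card ι := by
  obtain ⟨N, hN, h⟩ := hu
  have := 𝒮.finite_quotient hN.1
  have := Fintype.ofFinite (𝒮.G ⧸ powGroup 𝒮.T N)
  refine ⟨𝒮.G ⧸ powGroup 𝒮.T N, inferInstance, ⟨(1 : 𝒮.G)⟩, Quotient.out,
    fun g => ⟨g, h.apply_out hN g⟩, fun φ => ?_⟩
  rw [avg_eq hN (h.comp φ), mean_eq_sum]

lemma avg_mul_right {f : 𝒮.G → ℝ} (hf : IsPeriodic 𝒮.T f) (x : 𝒮.G) :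
    avg (fun g => f (g * x)) = avg f := by
  obtain ⟨N, hN, h⟩ := hf
  have := 𝒮.finite_quotient hN.1
  have := Fintype.ofFinite (𝒮.G ⧸ powGroup 𝒮.T N)
  rw [avg_eq hN h, avg_eq hN (h.mul_right hN x), mean_eq_sum, mean_eq_sum,
    sum_out_mul_right hN h]

variable {f h : 𝒮.G → ℝ}

lemma avg_add (hf : IsPeriodic 𝒮.T f) (hh : IsPeriodic 𝒮.T h) :
    avg (fun g => f g + h g) = avg f + avg h := by
  obtain ⟨ι, _, _, s, -, e⟩ := exists_avg_eq (isPeriodic_prodMk hf hh)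
  have e₁ := e Prod.fst
  have e₂ := e Prod.snd
  have e₃ := e fun p => p.1 + p.2
  simp only at e₁ e₂ e₃
  rw [e₁, e₂, e₃, Finset.sum_add_distrib, add_div]

lemma avg_const_mul (hf : IsPeriodic 𝒮.T f) (c : ℝ) :
    avg (fun g => c * f g) = c * avg f := by
  obtain ⟨ι, _, _, s, -, e⟩ := exists_avg_eq hf
  have e₁ := e id
  simp only [id] at e₁
  rw [e₁, e, ← Finset.mul_sum, mul_div_assoc]

lemma avg_sub (hf : IsPeriodic 𝒮.T f) (hh : IsPeriodic 𝒮.T h) :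
    avg (fun g => f g - h g) = avg f - avg h := by
  have h1 := avg_add hf (hh.comp fun x => (-1 : ℝ) * x)
  rw [avg_const_mul hh] at h1
  simpa [sub_eq_add_neg] using h1

lemma avg_mono (hf : IsPeriodic 𝒮.T f) (hh : IsPeriodic 𝒮.T h) (hle : ∀ g, f g ≤ h g) :
    avg f ≤ avg h := by
  obtain ⟨ι, _, _, s, -, e⟩ := exists_avg_eq (isPeriodic_prodMk hf hh)
  have e₁ := e Prod.fst
  have e₂ := e Prod.snd
  simp only at e₁ e₂
  rw [e₁, e₂]
  gcongr
  exact hle _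

lemma avg_nonneg (hf : ∀ g, 0 ≤ f g) : 0 ≤ avg f := by
  rw [avg]
  split_ifs with hp
  · have := 𝒮.finite_quotient hp.choose_spec.1.1
    have := Fintype.ofFinite (𝒮.G ⧸ powGroup 𝒮.T hp.choose)
    rw [mean_eq_sum]
    exact div_nonneg (Finset.sum_nonneg fun _ _ => hf _) (Nat.cast_nonneg _)
  -- A non-periodic function has average `0` by convention.
  · rfl

lemma abs_avg_le {C : ℝ} (hf : IsPeriodic 𝒮.T f) (hle : ∀ g, |f g| ≤ C) : |avg f| ≤ C := by
  obtain ⟨ι, _, _, s, -, e⟩ := exists_avg_eq hf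
  have e₁ := e id
  simp only [id] at e₁
  rw [e₁, abs_div, Nat.abs_cast, div_le_iff₀ (by positivity)]
  refine (Finset.abs_sum_le_sum_abs _ _).trans ((Finset.sum_le_sum fun i _ => hle (s i)).trans ?_)
  simp [mul_comm]

lemma abs_avg_le_avg (hf : IsPeriodic 𝒮.T f) (hh : IsPeriodic 𝒮.T h)
    (hle : ∀ g, |f g| ≤ h g) : |avg f| ≤ avg h := by
  refine abs_le.mpr ⟨?_, avg_mono hf hh fun g => (abs_le.mp (hle g)).2⟩
  rw [← neg_one_mul, ← avg_const_mul hh]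
  refine avg_mono (hh.comp fun x => -1 * x) hf fun g => ?_
  rw [neg_one_mul]
  exact (abs_le.mp (hle g)).1

lemma avg_sum {ι : Type*} (A : Finset ι) (f : ι → 𝒮.G → ℝ) (hf : IsPeriodic 𝒮.T fun g i => f i g) :
    avg (fun g => ∑ i ∈ A, f i g) = ∑ i ∈ A, avg (f i) := by
  obtain ⟨κ, _, _, s, -, e⟩ := exists_avg_eq hf
  have e₁ := e fun x => ∑ i ∈ A, x i
  have e₂ := fun i => e fun x => x i
  simp only at e₁ e₂
  rw [e₁, Finset.sum_congr rfl fun i _ => e₂ i, Finset.sum_comm, Finset.sum_div]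

/-- Cauchy-Schwarz for the finite sums that represent the averages. -/
lemma abs_avg_mul_le (hf : IsPeriodic 𝒮.T f) (hh : IsPeriodic 𝒮.T h) :
    |avg fun g => f g * h g| ≤
      √(avg fun g => f g ^ 2) * √(avg fun g => h g ^ 2) := by
  obtain ⟨ι, _, _, s, -, e⟩ := exists_avg_eq (isPeriodic_prodMk hf hh)
  have e₁ := e fun p => p.1 ^ 2
  have e₂ := e fun p => p.2 ^ 2
  have e₃ := e fun p => p.1 * p.2
  simp only at e₁ e₂ e₃
  rw [e₁, e₂, e₃, ← Real.sqrt_mul (by positivity)]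
  apply Real.abs_le_sqrt
  rw [div_pow, div_mul_div_comm, ← sq]
  gcongr
  exact Finset.sum_mul_sq_le_sq_mul_sq _ _ _

lemma eq_zero_of_avg_eq_zero (hf : IsPeriodic 𝒮.T f) (h0 : ∀ g, 0 ≤ f g) (hz : avg f = 0)
    (g : 𝒮.G) : f g = 0 := by
  obtain ⟨ι, _, _, s, hs, e⟩ := exists_avg_eq hf
  have e₁ := e id
  simp only [id] at e₁
  rw [hz, eq_comm, div_eq_zero_iff, or_iff_left (by simp),
    Finset.sum_eq_zero_iff_of_nonneg fun _ _ => h0 _] at e₁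
  obtain ⟨i, hi⟩ := hs g
  rw [← hi, e₁ i (Finset.mem_univ _)]

/-! ### The strain -/

variable (𝒮) in
lemma isPeriodic_val (u : 𝒮.UPer) : IsPeriodic 𝒮.T (𝒮.val u) := u.2

lemma val_add (u v : 𝒮.UPer) (g : 𝒮.G) : 𝒮.val (u + v) g = 𝒮.val u g + 𝒮.val v g := rfl

lemma val_sub (u v : 𝒮.UPer) (g : 𝒮.G) : 𝒮.val (u - v) g = 𝒮.val u g - 𝒮.val v g := rfl

lemma val_smul (c : ℝ) (u : 𝒮.UPer) (g : 𝒮.G) : 𝒮.val (c • u) g = c • 𝒮.val u g := rfl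

lemma norm_val_le (u : 𝒮.UPer) (g : 𝒮.G) : ‖𝒮.val u g‖ ≤ ‖u‖ :=
  lp.norm_apply_le_norm ENNReal.top_ne_zero _ g

/-- The deviation of `u` from a translation between `g` and `g h`. -/
def diff (u : 𝒮.UPer) (h g : 𝒮.G) : Space d₁ d₂ :=
  rot (h : Euc (Space d₁ d₂)) (𝒮.val u (g * h)) - 𝒮.val u g

lemma norm_diff_le (u : 𝒮.UPer) (h g : 𝒮.G) : ‖diff u h g‖ ≤ 2 * ‖u‖ := by
  refine (norm_sub_le _ _).trans ?_
  rw [LinearIsometryEquiv.norm_map, two_mul]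
  exact add_le_add (norm_val_le _ _) (norm_val_le _ _)

lemma isPeriodicWith_diff {u : 𝒮.UPer} {N : ℕ} (hN : N ∈ periods 𝒮.T)
    (hu : IsPeriodicWith 𝒮.T N (𝒮.val u)) : IsPeriodicWith 𝒮.T N fun g h => diff u h g :=
  fun g t ht => funext fun h => by
    have h1 := hu.mul_right hN h g t ht
    simp only [diff, hu g t ht, h1]

lemma isPeriodic_diff (u : 𝒮.UPer) : IsPeriodic 𝒮.T fun g h => diff u h g :=
  let ⟨N, hN, hu⟩ := 𝒮.isPeriodic_val u
  ⟨N, hN, isPeriodicWith_diff hN hu⟩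

/-- The family of all deviations of `u` from a translation, seen from `g`. -/
def strain (g : 𝒮.G) : 𝒮.UPer →L[ℝ] lp (fun _ : 𝒮.Punctured => Space d₁ d₂) ∞ :=
  LinearMap.mkContinuous
    { toFun u := ⟨fun h => diff u h.1 g, memℓp_infty
        ⟨2 * ‖u‖, by rintro _ ⟨h, rfl⟩; exact norm_diff_le u h.1 g⟩⟩
      map_add' u v := by
        ext1; funext h
        change diff (u + v) h.1 g = diff u h.1 g + diff v h.1 g
        simp only [diff, val_add, map_add]
        abel
      map_smul' c u := by
        ext1; funext h
        change diff (c • u) h.1 g = c • diff u h.1 g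
        simp only [diff, val_smul, map_smul, smul_sub] }
    2 fun u => lp.norm_le_of_forall_le (by positivity) fun h => norm_diff_le u h.1 g

lemma strain_apply (g : 𝒮.G) (u : 𝒮.UPer) (h : 𝒮.Punctured) :
    strain g u h = diff u h.1 g := rfl

lemma norm_strain_le (g : 𝒮.G) (u : 𝒮.UPer) : ‖strain g u‖ ≤ 2 * ‖u‖ :=
  lp.norm_le_of_forall_le (by positivity) fun h => norm_diff_le u h.1 g

lemma isPeriodicWith_strain {u : 𝒮.UPer} {N : ℕ} (hN : N ∈ periods 𝒮.T)
    (hu : IsPeriodicWith 𝒮.T N (𝒮.val u)) : IsPeriodicWith 𝒮.T N fun g => strain g u :=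
  fun g t ht => by
    ext1; funext h
    exact congrFun (isPeriodicWith_diff hN hu g t ht) h.1

lemma isPeriodic_strain (u : 𝒮.UPer) : IsPeriodic 𝒮.T fun g => strain g u :=
  let ⟨N, hN, hu⟩ := 𝒮.isPeriodic_val u
  ⟨N, hN, isPeriodicWith_strain hN hu⟩

/-- The potential as a function of the strain. -/
def strainPotential (V : (𝒮.Punctured → Space d₁ d₂) → ℝ)
    (z : lp (fun _ : 𝒮.Punctured => Space d₁ d₂) ∞) : ℝ :=
  V fun h => ((h.1 : Euc (Space d₁ d₂)) 𝒮.x₀ - 𝒮.x₀) + z h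

/-- Applying `rot g` to the shifted strain seen from `g` produces exactly the differences of
deformed positions, and `V` does not notice this rotation. -/
lemma potential_eq_strainPotential {V : (𝒮.Punctured → Space d₁ d₂) → ℝ}
    (hV : 𝒮.IsPotential V) (w : 𝒮.UPer) (g : 𝒮.G) :
    (V fun h => ((g * h.1 : 𝒮.G) : Euc (Space d₁ d₂)) (𝒮.val w (g * h.1))
      - (g : Euc (Space d₁ d₂)) (𝒮.val w g)) =
      strainPotential V (strain g (w - 𝒮.identity)) := by
  rw [strainPotential, ← hV.invariant (rot (g : Euc (Space d₁ d₂))) fun h =>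
    ((h.1 : Euc (Space d₁ d₂)) 𝒮.x₀ - 𝒮.x₀) + strain g (w - 𝒮.identity) h]
  congr 1
  funext h
  have hid : ∀ k, 𝒮.val 𝒮.identity k = 𝒮.x₀ := fun _ => rfl
  rw [strain_apply, diff, val_sub, val_sub, hid, hid, rot_apply_sub (h.1 : Euc (Space d₁ d₂))]
  have e : ∀ a b c e : Space d₁ d₂, a - b + (c - a - (e - b)) = c - e := by intros; abel
  rw [e, rot_apply_sub]
  rfl

/-- The period in `energy` is chosen separately for each `w`; `avg` does not depend on such a
choice, which makes the energy accessible to differentiation. -/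
lemma energy_eq_avg {V : (𝒮.Punctured → Space d₁ d₂) → ℝ} (hV : 𝒮.IsPotential V) (w : 𝒮.UPer) :
    𝒮.energy V w = avg fun g => strainPotential V (strain g (w - 𝒮.identity)) := by
  have hw : 𝒮.period w ∈ periods 𝒮.T ∧ IsPeriodicWith 𝒮.T (𝒮.period w) (𝒮.val w) :=
    Exists.choose_spec w.2
  have hsub : IsPeriodicWith 𝒮.T (𝒮.period w) (𝒮.val (w - 𝒮.identity)) := fun g t ht =>
    congrArg (fun x => x - 𝒮.x₀) (hw.2 g t ht)
  rw [avg_eq hw.1 ((isPeriodicWith_strain hw.1 hsub).comp (strainPotential V))]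
  exact congrArg (mean 𝒮.T (𝒮.period w)) (funext (potential_eq_strainPotential hV w))

end ObjectiveStructure

/-- A function with locally Lipschitz derivative has a quadratic Taylor remainder. -/
lemma abs_taylor_le {Z : Type*} [NormedAddCommGroup Z] [NormedSpace ℝ Z] {F : Z → ℝ}
    (hF : Differentiable ℝ F) {K : NNReal} {s : Set Z} (hs : Convex ℝ s)
    (hK : LipschitzOnWith K (fderiv ℝ F) s) {x y : Z} (hx : x ∈ s) (hy : y ∈ s) :
    |F y - F x - fderiv ℝ F x (y - x)| ≤ K * ‖y - x‖ * ‖y - x‖ := by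
  -- On this convex set the derivative differs from its value at `x` by at most `K ‖y - x‖`, so the
  -- mean value inequality applies.
  have hc : Convex ℝ (s ∩ Metric.closedBall x ‖y - x‖) := hs.inter (convex_closedBall _ _)
  refine hc.norm_image_sub_le_of_norm_hasFDerivWithin_le' (f := F) (f' := fderiv ℝ F)
    (fun z _ => (hF z).hasFDerivAt.hasFDerivWithinAt) (fun z hz => ?_)
    ⟨hx, by simp⟩ ⟨hy, by simp [dist_eq_norm]⟩
  refine (hK.norm_sub_le hz.1 hx).trans ?_
  gcongr
  simpa [dist_eq_norm] using hz.2

namespace ObjectiveStructure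

variable {d₁ d₂ : ℕ} {𝒮 : ObjectiveStructure d₁ d₂}

/-! ### Differentiation of averaged potentials. -/

section Calculus

variable {W Z : Type*} [NormedAddCommGroup W] [NormedSpace ℝ W] [NormedAddCommGroup Z]
  [NormedSpace ℝ Z] {L : 𝒮.G → W →L[ℝ] Z}

/-- The derivative of the averaged potential. -/
def avgDeriv (hL : ∀ w, IsPeriodic 𝒮.T fun g => L g w) (hL' : ∀ g w, ‖L g w‖ ≤ 2 * ‖w‖)
    (F : Z → ℝ) (w : W) : W →L[ℝ] ℝ :=
  LinearMap.mkContinuousOfExistsBound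
    { toFun u := avg fun g => fderiv ℝ F (L g w) (L g u)
      map_add' u v := by
        have hp := isPeriodic_prodMk (hL w)
          (isPeriodic_prodMk (hL u) (hL v))
        simp only [map_add]
        exact avg_add (hp.comp fun p => fderiv ℝ F p.1 p.2.1)
          (hp.comp fun p => fderiv ℝ F p.1 p.2.2)
      map_smul' c u := by
        have hp := isPeriodic_prodMk (hL w) (hL u)
        simp only [map_smul, smul_eq_mul]
        exact avg_const_mul (hp.comp fun p => fderiv ℝ F p.1 p.2) c }
    (by
      -- For fixed `w` only finitely many strains `L g w` occur, so the norms of the derivatives are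
      -- bounded.
      obtain ⟨C, hC⟩ := (finite_range_of_isPeriodic
        ((hL w).comp fun z => ‖fderiv ℝ F z‖)).bddAbove
      refine ⟨C * 2, fun u => ?_⟩
      have hp := isPeriodic_prodMk (hL w) (hL u)
      refine abs_avg_le (hp.comp fun p => fderiv ℝ F p.1 p.2) fun g => ?_
      have hg : ‖fderiv ℝ F (L g w)‖ ≤ C := hC ⟨g, rfl⟩
      rw [mul_assoc]
      exact ContinuousLinearMap.le_of_opNorm_le_of_le _ hg (hL' g u))

lemma avgDeriv_apply (hL : ∀ w, IsPeriodic 𝒮.T fun g => L g w)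
    (hL' : ∀ g w, ‖L g w‖ ≤ 2 * ‖w‖) (F : Z → ℝ) (w u : W) :
    avgDeriv hL hL' F w u = avg fun g => fderiv ℝ F (L g w) (L g u) := rfl

/-- The average of a bilinear form in the strains. -/
def avgForm (hL : ∀ w, IsPeriodic 𝒮.T fun g => L g w) (hL' : ∀ g w, ‖L g w‖ ≤ 2 * ‖w‖)
    (B : Z →L[ℝ] Z →L[ℝ] ℝ) : W →L[ℝ] W →L[ℝ] ℝ :=
  LinearMap.mkContinuous₂
    (LinearMap.mk₂ ℝ (fun u v => avg fun g => B (L g u) (L g v))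
      (fun u u' v => by
        have hp := isPeriodic_prodMk (hL v)
          (isPeriodic_prodMk (hL u) (hL u'))
        simp only [map_add, add_apply]
        exact avg_add (hp.comp fun p => B p.2.1 p.1) (hp.comp fun p => B p.2.2 p.1))
      (fun c u v => by
        have hp := isPeriodic_prodMk (hL u) (hL v)
        simp only [map_smul, smul_apply, smul_eq_mul]
        exact avg_const_mul (hp.comp fun p => B p.1 p.2) c)
      (fun u v v' => by
        have hp := isPeriodic_prodMk (hL u)
          (isPeriodic_prodMk (hL v) (hL v'))
        simp only [map_add]
        exact avg_add (hp.comp fun p => B p.1 p.2.1) (hp.comp fun p => B p.1 p.2.2))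
      (fun c u v => by
        have hp := isPeriodic_prodMk (hL u) (hL v)
        simp only [map_smul, smul_eq_mul]
        exact avg_const_mul (hp.comp fun p => B p.1 p.2) c))
    (‖B‖ * 2 * 2) fun u v => by
      have hp := isPeriodic_prodMk (hL u) (hL v)
      refine abs_avg_le (hp.comp fun p => B p.1 p.2) fun g => ?_
      refine (B.le_opNorm₂ _ _).trans ?_
      have h₁ := hL' g u
      have h₂ := hL' g v
      calc _ ≤ ‖B‖ * (2 * ‖u‖) * (2 * ‖v‖) := by gcongr
        _ = _ := by ring

lemma avgForm_apply (hL : ∀ w, IsPeriodic 𝒮.T fun g => L g w)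
    (hL' : ∀ g w, ‖L g w‖ ≤ 2 * ‖w‖) (B : Z →L[ℝ] Z →L[ℝ] ℝ) (u v : W) :
    avgForm hL hL' B u v = avg fun g => B (L g u) (L g v) := rfl

/-- The averaged potential is differentiable near `0`. -/
lemma eventually_hasFDerivAt_avg (hL : ∀ w, IsPeriodic 𝒮.T fun g => L g w)
    (hL' : ∀ g w, ‖L g w‖ ≤ 2 * ‖w‖) {F : Z → ℝ} (hF : ContDiff ℝ 2 F) :
    ∀ᶠ w in 𝓝 (0 : W),
      HasFDerivAt (fun w => avg fun g => F (L g w)) (avgDeriv hL hL' F w) w := by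
  have hd : Differentiable ℝ F := hF.differentiable (by norm_num)
  have hF1 : ContDiff ℝ 1 (fderiv ℝ F) := hF.fderiv_right (by norm_num)
  -- A C¹ derivative is Lipschitz near `0`. As `‖L g w‖ ≤ 2‖w‖`, the ball of radius `ρ / 2` is
  -- mapped into the Lipschitz region for all `g` at once.
  obtain ⟨K, t, ht, hK⟩ := (hF1.contDiffAt (x := 0)).exists_lipschitzOnWith
  obtain ⟨ρ, hρ, hball⟩ := Metric.mem_nhds_iff.mp ht
  replace hK := hK.mono hball
  have hmem : ∀ w ∈ Metric.ball (0 : W) (ρ / 2), ∀ g,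
      L g w ∈ Metric.ball (0 : Z) ρ := by
    intro w hw g
    rw [mem_ball_zero_iff] at *
    linarith [hL' g w]
  filter_upwards [Metric.ball_mem_nhds (0 : W) (half_pos hρ)] with w hw
  refine .of_isLittleO (Asymptotics.IsBigO.trans_isLittleO (.of_bound (K * 2 * 2) ?_)
    (Asymptotics.isLittleO_pow_sub_sub w one_lt_two))
  filter_upwards [Metric.isOpen_ball.mem_nhds hw] with w' hw'
  have hp := isPeriodic_prodMk (hL w)
    (isPeriodic_prodMk (hL w') (hL (w' - w)))
  rw [avgDeriv_apply, ← avg_sub (hp.comp fun p => F p.2.1) (hp.comp fun p => F p.1),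
    ← avg_sub (hp.comp fun p => F p.2.1 - F p.1) (hp.comp fun p => fderiv ℝ F p.1 p.2.2)]
  refine abs_avg_le (hp.comp fun p => F p.2.1 - F p.1 - fderiv ℝ F p.1 p.2.2) fun g => ?_
  have h1 := abs_taylor_le hd (convex_ball _ _) hK (hmem w hw g) (hmem w' hw' g)
  rw [← map_sub] at h1
  refine h1.trans ?_
  have h2 := hL' g (w' - w)
  rw [norm_pow, norm_norm]
  calc _ ≤ K * (2 * ‖w' - w‖) * (2 * ‖w' - w‖) := by gcongr
    _ = _ := by ring

/-- The averaged potential is twice differentiable at `0`. -/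
lemma hasFDerivAt_avgDeriv (hL : ∀ w, IsPeriodic 𝒮.T fun g => L g w)
    (hL' : ∀ g w, ‖L g w‖ ≤ 2 * ‖w‖) {F : Z → ℝ} {B : Z →L[ℝ] Z →L[ℝ] ℝ}
    (hB : HasFDerivAt (fderiv ℝ F) B 0) :
    HasFDerivAt (avgDeriv hL hL' F) (avgForm hL hL' B) (0 : W) := by
  refine .of_isLittleO (Asymptotics.isLittleO_iff.mpr fun ε hε => ?_)
  -- The factor `1 / 4` absorbs the two factors `2` from bounding `L g w` and `L g u`.
  obtain ⟨δ, hδ, hball⟩ := Metric.eventually_nhds_iff_ball.mp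
    (Asymptotics.isLittleO_iff.mp hB.isLittleO (show 0 < ε / 4 by positivity))
  filter_upwards [Metric.ball_mem_nhds (0 : W) (half_pos hδ)] with w hw
  refine ContinuousLinearMap.opNorm_le_bound _ (by positivity) fun u => ?_
  have hp := isPeriodic_prodMk (hL w)
    (isPeriodic_prodMk (hL 0) (hL u))
  simp only [sub_apply, sub_zero]
  rw [avgDeriv_apply, avgDeriv_apply, avgForm_apply,
    ← avg_sub (hp.comp fun p => fderiv ℝ F p.1 p.2.2) (hp.comp fun p => fderiv ℝ F p.2.1 p.2.2),
    ← avg_sub (hp.comp fun p => fderiv ℝ F p.1 p.2.2 - fderiv ℝ F p.2.1 p.2.2)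
      (hp.comp fun p => B p.1 p.2.2)]
  refine abs_avg_le
    (hp.comp fun p => fderiv ℝ F p.1 p.2.2 - fderiv ℝ F p.2.1 p.2.2 - B p.1 p.2.2) fun g => ?_
  have h₁ := hL' g w
  have h₂ := hL' g u
  have h3 := hball (L g w) (by
    rw [mem_ball_zero_iff] at *
    linarith)
  simp only [sub_zero] at h3
  simp only [map_zero]
  have h4 := ContinuousLinearMap.le_of_opNorm_le_of_le
    (fderiv ℝ F (L g w) - fderiv ℝ F 0 - B (L g w)) h3 h₂
  refine h4.trans ?_
  calc _ ≤ ε / 4 * (2 * ‖w‖) * (2 * ‖u‖) := by gcongr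
    _ = _ := by ring

lemma eventually_hasFDerivAt_of_eq_avg (hL : ∀ w, IsPeriodic 𝒮.T fun g => L g w)
    (hL' : ∀ g w, ‖L g w‖ ≤ 2 * ‖w‖) {F : Z → ℝ} (hF : ContDiff ℝ 2 F) {E : W → ℝ} {w₀ : W}
    (hE : ∀ w, E w = avg fun g => F (L g (w - w₀))) :
    ∀ᶠ w in 𝓝 w₀, HasFDerivAt E (avgDeriv hL hL' F (w - w₀)) w := by
  have hlim : Filter.Tendsto (fun w => w - w₀) (𝓝 w₀) (𝓝 0) := by
    rw [← sub_self w₀]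
    exact (continuous_id.sub continuous_const).tendsto _
  filter_upwards [hlim.eventually (eventually_hasFDerivAt_avg hL hL' hF)] with w hw
  rw [funext hE]
  exact (hasFDerivAt_comp_sub w₀).mpr hw

lemma hasFDerivAt_fderiv_of_eq_avg (hL : ∀ w, IsPeriodic 𝒮.T fun g => L g w)
    (hL' : ∀ g w, ‖L g w‖ ≤ 2 * ‖w‖) {F : Z → ℝ} (hF : ContDiff ℝ 2 F) {E : W → ℝ} {w₀ : W}
    (hE : ∀ w, E w = avg fun g => F (L g (w - w₀))) :
    HasFDerivAt (fderiv ℝ E) (avgForm hL hL' (fderiv ℝ (fderiv ℝ F) 0)) w₀ := by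
  have hF1 : ContDiff ℝ 1 (fderiv ℝ F) := hF.fderiv_right (by norm_num)
  have h1 := hasFDerivAt_avgDeriv hL hL'
    ((hF1.differentiable (by norm_num)).differentiableAt (x := 0)).hasFDerivAt
  rw [← sub_self w₀] at h1
  have h2 := (hasFDerivAt_comp_sub w₀).mpr h1
  refine h2.congr_of_eventuallyEq ?_
  filter_upwards [eventually_hasFDerivAt_of_eq_avg hL hL' hF hE] with w hw using hw.fderiv

lemma fderiv_fderiv_of_eq_avg (hL : ∀ w, IsPeriodic 𝒮.T fun g => L g w)
    (hL' : ∀ g w, ‖L g w‖ ≤ 2 * ‖w‖) {F : Z → ℝ} (hF : ContDiff ℝ 2 F) {E : W → ℝ} {w₀ : W}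
    (hE : ∀ w, E w = avg fun g => F (L g (w - w₀))) (u v : W) :
    fderiv ℝ (fderiv ℝ E) w₀ u v = avg fun g => fderiv ℝ (fderiv ℝ F) 0 (L g u) (L g v) := by
  rw [(hasFDerivAt_fderiv_of_eq_avg hL hL' hF hE).fderiv, avgForm_apply]

end Calculus

/-! ### Derivatives of the energy at the identity deformation. -/

section Energy

variable {V : (𝒮.Punctured → Space d₁ d₂) → ℝ}

lemma contDiff_strainPotential (hV : 𝒮.IsPotential V) : ContDiff ℝ 2 (strainPotential V) :=
  hV.smooth _

lemma eventually_differentiableAt_energy (hV : 𝒮.IsPotential V) :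
    ∀ᶠ w in 𝓝 𝒮.identity, DifferentiableAt ℝ (𝒮.energy V) w :=
  (eventually_hasFDerivAt_of_eq_avg isPeriodic_strain norm_strain_le
    (contDiff_strainPotential hV) (energy_eq_avg hV)).mono fun _ hw => hw.differentiableAt

lemma differentiableAt_fderiv_energy (hV : 𝒮.IsPotential V) :
    DifferentiableAt ℝ (fderiv ℝ (𝒮.energy V)) 𝒮.identity :=
  (hasFDerivAt_fderiv_of_eq_avg isPeriodic_strain norm_strain_le
    (contDiff_strainPotential hV) (energy_eq_avg hV)).differentiableAt

lemma energyHess_apply (hV : 𝒮.IsPotential V) (u v : 𝒮.UPer) : 𝒮.energyHess V u v =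
    avg fun g => fderiv ℝ (fderiv ℝ (strainPotential V)) 0 (strain g u) (strain g v) :=
  fderiv_fderiv_of_eq_avg isPeriodic_strain norm_strain_le
    (contDiff_strainPotential hV) (energy_eq_avg hV) u v

end Energy

end ObjectiveStructure

lemma norm_add_sq_le_two_mul {X : Type*} [SeminormedAddCommGroup X] (x y : X) :
    ‖x + y‖ ^ 2 ≤ 2 * ‖x‖ ^ 2 + 2 * ‖y‖ ^ 2 := by
  have h1 := norm_add_le x y
  have h2 := norm_nonneg (x + y)
  nlinarith [sq_nonneg (‖x‖ - ‖y‖)]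

/-- The second derivative of a function that factors through a linear map `P`. -/
lemma fderiv_fderiv_apply_of_comp_eq {Z : Type*} [NormedAddCommGroup Z] [NormedSpace ℝ Z]
    {F : Z → ℝ} (hF : ContDiff ℝ 2 F) (P : Z →L[ℝ] Z) (hP : ∀ z, F (P z) = F z) (z z' : Z) :
    fderiv ℝ (fderiv ℝ F) 0 z z' = fderiv ℝ (fderiv ℝ F) 0 (P z) (P z') := by
  have hd : Differentiable ℝ F := hF.differentiable (by norm_num)
  have hd1 : Differentiable ℝ (fderiv ℝ F) :=
    (hF.fderiv_right (m := 1) (by norm_num)).differentiable (by norm_num)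
  have h1 : ∀ x, fderiv ℝ F x = (fderiv ℝ F (P x)).comp P := fun x => by
    have h := (hd (P x)).hasFDerivAt.comp x P.hasFDerivAt
    rw [show F ∘ P = F from funext hP] at h
    exact h.fderiv
  -- Differentiate `x ↦ F'(x) z'` at `0` twice over: directly, and through `F'(x) z' = F'(P x)(P
  -- z')`. Uniqueness of the derivative gives the claim.
  have h2 : HasFDerivAt (fun x => fderiv ℝ F x z') ((fderiv ℝ (fderiv ℝ F) 0).flip z') 0 := by
    have h := (hd1 0).hasFDerivAt.clm_apply (hasFDerivAt_const z' (0 : Z))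
    simpa using h
  have h3 : HasFDerivAt (fun x => fderiv ℝ F x z')
      (((fderiv ℝ (fderiv ℝ F) 0).flip (P z')).comp P) 0 := by
    have h := (hd1 (P 0)).hasFDerivAt.clm_apply (hasFDerivAt_const (P z') (P 0))
    have h' := h.comp (0 : Z) P.hasFDerivAt
    rw [map_zero] at h'
    have e : (fun x => fderiv ℝ F x z') = (fun x => fderiv ℝ F x (P z')) ∘ P := by
      funext x
      simp only [Function.comp_apply]
      rw [h1 x]
      rfl
    rw [e]
    simpa using h'
  have h4 := h2.unique h3
  have h5 := DFunLike.congr_fun h4 z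
  simpa using h5

namespace ObjectiveStructure

variable {d₁ d₂ : ℕ} {𝒮 : ObjectiveStructure d₁ d₂}

/-! ### Comparison with the seminorm -/

lemma diff_one (u : 𝒮.UPer) (g : 𝒮.G) : diff u 1 g = 0 := by
  simp only [diff, mul_one]
  exact sub_self _

/-- Cocycle identity: passing from `g` to `g h k` through `g h` adds up the deviations, the first
being carried along by an isometry. It spreads bounds from generators to the group. -/
lemma diff_mul (u : 𝒮.UPer) (h k g : 𝒮.G) :
    diff u (h * k) g = rot (h : Euc (Space d₁ d₂)) (diff u k (g * h)) + diff u h g := by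
  simp only [diff, map_sub, mul_assoc]
  have : rot ((h * k : 𝒮.G) : Euc (Space d₁ d₂)) (𝒮.val u (g * (h * k))) =
    rot (h : Euc (Space d₁ d₂)) (rot (k : Euc (Space d₁ d₂)) (𝒮.val u (g * (h * k)))) := rfl
  rw [this]
  abel

/-- The mean square deviation of `u` from a translation in the direction `h`. -/
def msd (u : 𝒮.UPer) (h : 𝒮.G) : ℝ := avg fun g => ‖diff u h g‖ ^ 2

lemma isPeriodic_norm_diff_sq (u : 𝒮.UPer) (h : 𝒮.G) :
    IsPeriodic 𝒮.T fun g => ‖diff u h g‖ ^ 2 :=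
  (isPeriodic_diff u).comp fun f => ‖f h‖ ^ 2

lemma msd_one (u : 𝒮.UPer) : msd u 1 = 0 := by
  have h := avg_const_mul (isPeriodic_norm_diff_sq u 1) 0
  simpa [msd, diff_one] using h

lemma msd_inv (u : 𝒮.UPer) (h : 𝒮.G) : msd u h⁻¹ = msd u h := by
  rw [msd, msd, ← avg_mul_right (isPeriodic_norm_diff_sq u h) h⁻¹]
  congr 1
  funext g
  -- The cocycle identity for `h h⁻¹ = 1`, based at `g h⁻¹`, shows that the two deviations have
  -- equal norm.
  have h1 := diff_mul u h h⁻¹ (g * h⁻¹)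
  rw [mul_inv_cancel, diff_one, inv_mul_cancel_right] at h1
  rw [← LinearIsometryEquiv.norm_map (rot (h : Euc (Space d₁ d₂))),
    eq_neg_of_add_eq_zero_left h1.symm, norm_neg]

/-- In the cocycle identity the first term is based at `g h`; invariance of the average under right
multiplication removes this shift. -/
lemma msd_mul_le (u : 𝒮.UPer) (h k : 𝒮.G) : msd u (h * k) ≤ 2 * msd u k + 2 * msd u h := by
  have hk := (isPeriodic_norm_diff_sq u k).mul_right h
  have hh := isPeriodic_norm_diff_sq u h
  rw [msd, msd, msd, ← avg_mul_right (isPeriodic_norm_diff_sq u k) h, ← avg_const_mul hk,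
    ← avg_const_mul hh, ← avg_add (hk.comp (2 * ·)) (hh.comp (2 * ·))]
  refine avg_mono (isPeriodic_norm_diff_sq u _)
    ((isPeriodic_prodMk hk hh).comp fun p => 2 * p.1 + 2 * p.2) fun g => ?_
  rw [diff_mul]
  refine (norm_add_sq_le_two_mul _ _).trans_eq ?_
  rw [LinearIsometryEquiv.norm_map]

lemma isPeriodicWith_restrict (R : Finset 𝒮.G) {u : 𝒮.UPer} {N : ℕ} (hN : N ∈ periods 𝒮.T)
    (hu : IsPeriodicWith 𝒮.T N (𝒮.val u)) : IsPeriodicWith 𝒮.T N (𝒮.restrict R u) :=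
  fun g t ht => congrArg (WithLp.toLp 2) (funext fun h => hu.mul_right hN h.1 g t ht)

/-- The squared norm of the projection of `u(g ·)|_R`. -/
def localSq (R : Finset 𝒮.G) (u : 𝒮.UPer) (g : 𝒮.G) : ℝ :=
  ‖(𝒮.UIso00 R)ᗮ.starProjection (𝒮.restrict R u g)‖ ^ 2

lemma isPeriodicWith_localSq (R : Finset 𝒮.G) {u : 𝒮.UPer} {N : ℕ} (hN : N ∈ periods 𝒮.T)
    (hu : IsPeriodicWith 𝒮.T N (𝒮.val u)) : IsPeriodicWith 𝒮.T N (localSq R u) :=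
  (isPeriodicWith_restrict R hN hu).comp fun x => ‖(𝒮.UIso00 R)ᗮ.starProjection x‖ ^ 2

lemma isPeriodic_localSq (R : Finset 𝒮.G) (u : 𝒮.UPer) : IsPeriodic 𝒮.T (localSq R u) :=
  let ⟨N, hN, hu⟩ := 𝒮.isPeriodic_val u
  ⟨N, hN, isPeriodicWith_localSq R hN hu⟩

lemma seminorm00_eq (R : Finset 𝒮.G) (u : 𝒮.UPer) :
    𝒮.seminorm00 R u = √(avg (localSq R u)) := by
  have hw : 𝒮.period u ∈ periods 𝒮.T ∧ IsPeriodicWith 𝒮.T (𝒮.period u) (𝒮.val u) :=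
    Exists.choose_spec u.2
  rw [avg_eq hw.1 (isPeriodicWith_localSq R hw.1 hw.2)]
  rfl

lemma seminorm00_nonneg (R : Finset 𝒮.G) (u : 𝒮.UPer) : 0 ≤ 𝒮.seminorm00 R u :=
  Real.sqrt_nonneg _

lemma seminorm00_sq (R : Finset 𝒮.G) (u : 𝒮.UPer) :
    𝒮.seminorm00 R u ^ 2 = avg (localSq R u) := by
  rw [seminorm00_eq, Real.sq_sqrt]
  exact avg_nonneg fun g => sq_nonneg ‖_‖

/-- If `d₁ = 1`, then there are no infinitesimal rotations with linear component `S₁ ⊕ 0`. -/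
lemma UIso00_le_UTrans (hd : d₁ = 1) (R : Finset 𝒮.G) :
    𝒮.UIso00 R ≤ 𝒮.UTrans R := by
  subst hd
  refine sup_le le_rfl ?_
  rintro u ⟨S, hS, hu⟩
  have h0 : S = 0 := by
    ext i j
    have h1 := congrFun (congrFun hS i) j
    rw [Subsingleton.elim j i, Matrix.transpose_apply, Matrix.neg_apply] at *
    simp only [Matrix.zero_apply]
    linarith
  refine ⟨0, fun g => ?_⟩
  rw [hu g, h0]
  simp only [blockMap, map_zero, LinearMap.zero_apply]
  rfl

/-- The component of `u(g ·)` removed by the projection is a translation, which cancels in the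
deviation. What remains are two entries of the projected field, each bounded by its norm; squaring
the sum gives the factor `4`. -/
lemma norm_diff_sq_le_localSq (hd : d₁ = 1) {R : Finset 𝒮.G} (h1 : 1 ∈ R)
    {h : 𝒮.G} (hh : h ∈ R) (u : 𝒮.UPer) (g : 𝒮.G) :
    ‖diff u h g‖ ^ 2 ≤ 4 * localSq R u g := by
  set x := 𝒮.restrict R u g with hx
  set p := (𝒮.UIso00 R)ᗮ.starProjection x with hp
  have hq : (𝒮.UIso00 R).starProjection x ∈ 𝒮.UTrans R :=
    UIso00_le_UTrans hd R (Submodule.starProjection_apply_mem _ _)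
  obtain ⟨a, ha⟩ := hq
  have hxp : x = (𝒮.UIso00 R).starProjection x + p :=
    (Submodule.starProjection_add_starProjection_orthogonal x).symm
  have hk : ∀ k : R, rot (k.1 : Euc (Space d₁ d₂)) (𝒮.val u (g * k.1)) =
      a + rot (k.1 : Euc (Space d₁ d₂)) (p k) := fun k => by
    rw [← ha k, ← map_add, ← PiLp.add_apply, ← hxp]
    rfl
  have hd : diff u h g = rot (h : Euc (Space d₁ d₂)) (p ⟨h, hh⟩) + -p ⟨1, h1⟩ := by
    have e1 := hk ⟨h, hh⟩
    have e2 := hk ⟨1, h1⟩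
    have e3 : 𝒮.val u g = a + p ⟨1, h1⟩ := by
      rw [mul_one] at e2
      exact e2
    rw [diff, e1, e3]
    abel
  rw [hd, localSq]
  refine (norm_add_sq_le_two_mul _ _).trans ?_
  rw [LinearIsometryEquiv.norm_map, norm_neg]
  have b1 := PiLp.norm_apply_le p ⟨h, hh⟩
  have b2 := PiLp.norm_apply_le p ⟨1, h1⟩
  have c1 := pow_le_pow_left₀ (norm_nonneg _) b1 2
  have c2 := pow_le_pow_left₀ (norm_nonneg _) b2 2
  linarith

/-- The mean square deviation in every direction is bounded in terms of the seminorm. -/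
lemma exists_msd_le (hd : d₁ = 1) {R : Finset 𝒮.G}
    (hR : 𝒮.HasProperty2 (R : Set 𝒮.G)) (h : 𝒮.G) :
    ∃ C : ℝ, 0 ≤ C ∧ ∀ u : 𝒮.UPer, msd u h ≤ C * 𝒮.seminorm00 R u ^ 2 := by
  obtain ⟨-, R', R'', h1', hgen, ⟨-, h1'', -⟩, hsub⟩ := hR
  -- Since `1 ∈ R''`, the generators themselves lie in `R`, and so does `1 ∈ R'`.
  have hR' : ∀ r ∈ R', r ∈ R := fun r hr => by simpa using hsub r hr 1 h1''
  have hmem : h ∈ Subgroup.closure R' := hgen ▸ Subgroup.mem_top h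
  induction hmem using Subgroup.closure_induction with
  | mem r hr =>
    refine ⟨4, by norm_num, fun u => ?_⟩
    rw [seminorm00_sq, ← avg_const_mul (isPeriodic_localSq R u)]
    exact avg_mono (isPeriodic_norm_diff_sq u r) ((isPeriodic_localSq R u).comp (4 * ·))
      (norm_diff_sq_le_localSq hd (hR' 1 h1') (hR' r hr) u)
  | one => exact ⟨0, le_rfl, fun u => by rw [msd_one, zero_mul]⟩
  | mul x y _ _ hx hy =>
    obtain ⟨C, hC, hx⟩ := hx
    obtain ⟨D, hD, hy⟩ := hy
    refine ⟨2 * D + 2 * C, by positivity, fun u => (msd_mul_le u x y).trans ?_⟩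
    linarith [hx u, hy u]
  | inv x _ hx =>
    obtain ⟨C, hC, hx⟩ := hx
    exact ⟨C, hC, fun u => by rw [msd_inv]; exact hx u⟩

/-- Restriction of strains to a set of interactions. -/
def truncate (A : Set 𝒮.Punctured) : lp (fun _ : 𝒮.Punctured => Space d₁ d₂) ∞ →L[ℝ]
    lp (fun _ : 𝒮.Punctured => Space d₁ d₂) ∞ :=
  have hle : ∀ (z : lp (fun _ : 𝒮.Punctured => Space d₁ d₂) ∞) h, ‖A.indicator z h‖ ≤ ‖z‖ :=
    fun z h => (norm_indicator_le_norm_self _ _).trans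
      (lp.norm_apply_le_norm ENNReal.top_ne_zero z h)
  LinearMap.mkContinuous
    { toFun z := ⟨A.indicator z, memℓp_infty ⟨‖z‖, by rintro _ ⟨h, rfl⟩; exact hle z h⟩⟩
      map_add' z z' := by ext1; exact Set.indicator_add A z z'
      map_smul' c z := by ext1; exact Set.indicator_const_smul A c z }
    1 fun z => by
      rw [one_mul]
      exact lp.norm_le_of_forall_le (norm_nonneg _) (hle z)

lemma truncate_apply (A : Set 𝒮.Punctured) (z : lp (fun _ : 𝒮.Punctured => Space d₁ d₂) ∞)
    (h : 𝒮.Punctured) : truncate A z h = A.indicator z h := rfl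

/-- Truncation alters the strain only outside `A`, where `V` ignores its argument. -/
lemma strainPotential_truncate {V : (𝒮.Punctured → Space d₁ d₂) → ℝ} {A : Set 𝒮.Punctured}
    (hA : ∀ y, V y = V (A.indicator y)) (z : lp (fun _ : 𝒮.Punctured => Space d₁ d₂) ∞) :
    strainPotential V (truncate A z) = strainPotential V z := by
  rw [strainPotential, strainPotential, hA, hA fun h => _ + z h]
  congr 1
  funext h
  by_cases hh : h ∈ A
  · simp only [Set.indicator_of_mem hh, truncate_apply]
  · simp only [Set.indicator_of_notMem hh]

lemma norm_truncate_sq_le (A : Finset 𝒮.Punctured)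
    (z : lp (fun _ : 𝒮.Punctured => Space d₁ d₂) ∞) :
    ‖truncate (A : Set 𝒮.Punctured) z‖ ^ 2 ≤ ∑ h ∈ A, ‖z h‖ ^ 2 := by
  have h0 : 0 ≤ ∑ h ∈ A, ‖z h‖ ^ 2 := Finset.sum_nonneg fun _ _ => sq_nonneg _
  refine (Real.le_sqrt (norm_nonneg _) h0).mp
    (lp.norm_le_of_forall_le (Real.sqrt_nonneg _) fun h => ?_)
  rw [truncate_apply]
  by_cases hh : h ∈ A
  · rw [Set.indicator_of_mem (Finset.mem_coe.mpr hh)]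
    refine Real.le_sqrt_of_sq_le ?_
    exact Finset.single_le_sum (f := fun h => ‖z h‖ ^ 2) (fun _ _ => sq_nonneg _) hh
  · rw [Set.indicator_of_notMem (by simpa using hh), norm_zero]
    exact Real.sqrt_nonneg _

/-- The constants for single directions may depend on the direction; finite range allows them to be
summed. -/
lemma exists_avg_norm_truncate_sq_le (hd : d₁ = 1) {R : Finset 𝒮.G}
    (hR : 𝒮.HasProperty2 (R : Set 𝒮.G)) (A : Finset 𝒮.Punctured) :
    ∃ C : ℝ, 0 ≤ C ∧ ∀ u : 𝒮.UPer,
      (avg fun g => ‖truncate (A : Set 𝒮.Punctured) (strain g u)‖ ^ 2) ≤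
        C * 𝒮.seminorm00 R u ^ 2 := by
  choose C hC hle using fun h : 𝒮.G => exists_msd_le hd hR h
  refine ⟨∑ h ∈ A, C h.1, Finset.sum_nonneg fun _ _ => hC _, fun u => ?_⟩
  calc _ ≤ avg fun g => ∑ h ∈ A, ‖diff u h.1 g‖ ^ 2 :=
        avg_mono ((isPeriodic_strain u).comp fun z => ‖truncate (A : Set 𝒮.Punctured) z‖ ^ 2)
          ((isPeriodic_diff u).comp fun f => ∑ h ∈ A, ‖f h.1‖ ^ 2)
          fun g => norm_truncate_sq_le A (strain g u)
    _ = ∑ h ∈ A, msd u h.1 :=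
        avg_sum A (fun h g => ‖diff u h.1 g‖ ^ 2)
          ((isPeriodic_diff u).comp fun f (h : 𝒮.Punctured) => ‖f h.1‖ ^ 2)
    _ ≤ _ := by
        rw [Finset.sum_mul]
        exact Finset.sum_le_sum fun h _ => hle h.1 u

lemma exists_abs_avg_bilin_le {W Z : Type*} [NormedAddCommGroup Z] [NormedSpace ℝ Z]
    {L : 𝒮.G → W → Z} (hL : ∀ w, IsPeriodic 𝒮.T fun g => L g w) {P : Z →L[ℝ] Z}
    {B : Z →L[ℝ] Z →L[ℝ] ℝ} (hB : ∀ z z', B z z' = B (P z) (P z')) {C : ℝ} (hC : 0 ≤ C)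
    {p : W → ℝ} (hp0 : ∀ u, 0 ≤ p u)
    (hle : ∀ u, (avg fun g => ‖P (L g u)‖ ^ 2) ≤ C * p u ^ 2) :
    ∃ D : ℝ, 0 < D ∧ ∀ u v, |avg fun g => B (L g u) (L g v)| ≤ D * p u * p v := by
  -- The summand `1` only ensures positivity of the constant.
  refine ⟨‖B‖ * C + 1, by positivity, fun u v => ?_⟩
  have hsqrt : ∀ u, √(avg fun g => ‖P (L g u)‖ ^ 2) ≤
      √C * p u := fun u => by
    rw [← Real.sqrt_sq (hp0 u), ← Real.sqrt_mul hC]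
    exact Real.sqrt_le_sqrt (hle u)
  have hu := (hL u).comp fun z => ‖P z‖
  have hv := (hL v).comp fun z => ‖P z‖
  have hp := isPeriodic_prodMk (hL u) (hL v)
  have hprod := (isPeriodic_prodMk hu hv).comp fun p => p.1 * p.2
  have hn := mul_nonneg (hp0 u) (hp0 v)
  have hb : ∀ g, |B (L g u) (L g v)| ≤
      ‖B‖ * (‖P (L g u)‖ * ‖P (L g v)‖) := fun g => by
    rw [hB, ← mul_assoc]
    exact B.le_opNorm₂ _ _
  have hbp := hp.comp fun p => B p.1 p.2
  have h1 : |avg fun g => B (L g u) (L g v)| ≤ ‖B‖ * avg fun g =>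
      ‖P (L g u)‖ * ‖P (L g v)‖ := by
    rw [← avg_const_mul hprod]
    exact abs_avg_le_avg hbp (hprod.comp (‖B‖ * ·)) hb
  have h2 := (le_abs_self _).trans (abs_avg_mul_le hu hv)
  have h3 := mul_le_mul (hsqrt u) (hsqrt v) (Real.sqrt_nonneg _)
    (mul_nonneg (Real.sqrt_nonneg _) (hp0 u))
  rw [mul_mul_mul_comm, Real.mul_self_sqrt hC] at h3
  have h4 := h1.trans (mul_le_mul_of_nonneg_left (h2.trans h3) (norm_nonneg B))
  linarith

/-- The second derivative of the energy is bounded with respect to the seminorm. -/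
lemma boundedWrt_energyHess (hd : d₁ = 1)
    {V : (𝒮.Punctured → Space d₁ d₂) → ℝ} (hV : 𝒮.IsPotential V) {R : Finset 𝒮.G}
    (hR : 𝒮.HasProperty2 (R : Set 𝒮.G)) :
    BoundedWrt (fun u v => 𝒮.energyHess V u v) (𝒮.seminorm00 R) :=
  hV.finiteRange.elim fun _ hA =>
    (exists_avg_norm_truncate_sq_le hd hR hA.1.toFinset).elim fun _ hC =>
      (exists_abs_avg_bilin_le isPeriodic_strain (fderiv_fderiv_apply_of_comp_eq
        (contDiff_strainPotential hV)
        (truncate _) (strainPotential_truncate (hA.1.coe_toFinset.symm ▸ hA.2)))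
        hC.1 (seminorm00_nonneg R) hC.2).elim
        fun D hD => ⟨D, hD.1, fun u v =>
          (congrArg abs (energyHess_apply hV u v)).le.trans (hD.2 u v)⟩

/-- The seminorm does not vanish identically if `G` is non-trivial. -/
lemma exists_seminorm00_pos (hd : d₁ = 1) (hG : 𝒮.G ≠ ⊥) {R : Finset 𝒮.G}
    (hR : 𝒮.HasProperty2 (R : Set 𝒮.G)) : ∃ u : 𝒮.UPer, 0 < 𝒮.seminorm00 R u := by
  classical
  obtain ⟨N, hN, hne⟩ := 𝒮.exists_powGroup_ne_top hG
  set H := powGroup 𝒮.T N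
  -- A non-zero vector, since the first factor has dimension one.
  let a : Space d₁ d₂ := WithLp.toLp 2 (WithLp.toLp 2 fun _ => 1, 0)
  have ha : a ≠ 0 := fun h => by
    have h1 : a.fst ⟨0, by omega⟩ = (0 : Vec d₁) ⟨0, by omega⟩ := by rw [h]; rfl
    exact one_ne_zero h1
  let f : 𝒮.G → Space d₁ d₂ := fun g => if g ∈ H then a else 0
  let u : 𝒮.UPer := ⟨⟨f, memℓp_infty ⟨‖a‖, by
    rintro _ ⟨g, rfl⟩
    simp only [f]
    split_ifs <;> simp⟩⟩, N, hN, .of_mul_mem fun g s hs => by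
      change f (g * s) = f g
      simp only [f, H.mul_mem_cancel_right hs]⟩
  have hval : ∀ g, 𝒮.val u g = f g := fun _ => rfl
  refine ⟨u, (seminorm00_nonneg R u).lt_of_ne fun h0 => hne ?_⟩
  refine (Subgroup.eq_top_iff' _).mpr fun h => ?_
  obtain ⟨C, hC, hle⟩ := exists_msd_le hd hR h
  have h1 : msd u h = 0 := by
    refine le_antisymm ?_ (avg_nonneg fun g => sq_nonneg _)
    have h2 := hle u
    rwa [← h0, zero_pow two_ne_zero, mul_zero] at h2
  -- At `g = 1` this says that `rot h` maps `f h` to `f 1 = a ≠ 0`, so `h` must lie in `H`.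
  have h2 := eq_zero_of_avg_eq_zero (isPeriodic_norm_diff_sq u h) (fun g => sq_nonneg _) h1 1
  rw [sq_eq_zero_iff, norm_eq_zero, diff, hval, hval, one_mul, sub_eq_zero] at h2
  by_contra hh
  have e1 : f h = 0 := if_neg hh
  have e2 : f 1 = a := if_pos H.one_mem
  rw [e1, e2, map_zero] at h2
  exact ha h2.symm

end ObjectiveStructure

/-- A bilinear form that is bounded with respect to a non-zero seminorm has a finite optimal
stability constant. -/
lemma BoundedWrt.exists_sSup_eq {W : Type*} {B : W → W → ℝ} {p : W → ℝ} (hB : BoundedWrt B p)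
    (hp : ∃ u, 0 < p u) : ∃ r : ℝ,
      sSup ((fun c : ℝ => (c : EReal)) '' {c : ℝ | ∀ u, c * p u ^ 2 ≤ B u u}) = (r : EReal) := by
  obtain ⟨C, -, hC⟩ := hB
  obtain ⟨u, hu⟩ := hp
  -- The bound makes `-C` admissible, so the supremum is not `-∞`; testing with `u`, where `p u >
  -- 0`, shows that no admissible `c` exceeds `C`.
  have hmem : -C ∈ {c : ℝ | ∀ u, c * p u ^ 2 ≤ B u u} := fun v => by
    have := (abs_le.mp (hC v v)).1
    linarith
  set s := sSup ((fun c : ℝ => (c : EReal)) '' {c : ℝ | ∀ u, c * p u ^ 2 ≤ B u u})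
  have hlow : ((-C : ℝ) : EReal) ≤ s := le_sSup ⟨_, hmem, rfl⟩
  have hup : s ≤ (C : EReal) := by
    refine sSup_le ?_
    rintro _ ⟨c, hc, rfl⟩
    refine EReal.coe_le_coe_iff.mpr ?_
    have h1 := (hc u).trans (abs_le.mp (hC u u)).2
    rw [mul_assoc, ← sq] at h1
    exact le_of_mul_le_mul_right h1 (by positivity)
  exact ⟨s.toReal, (EReal.coe_toReal (hup.trans_lt (EReal.coe_lt_top _)).ne
    ((EReal.bot_lt_coe _).trans_le hlow).ne').symm⟩

end ObjStr

end
theorem mainTheorem9 {d₁ d₂ : ℕ} (𝒮 : ObjStr.ObjectiveStructure d₁ d₂)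
    (hG : 𝒮.G ≠ ⊥)
    (V : (𝒮.Punctured → ObjStr.Space d₁ d₂) → ℝ) (hV : 𝒮.IsPotential V)
    (R : Finset 𝒮.G) (hR : 𝒮.HasProperty2 (R : Set 𝒮.G))
    (hd : d₁ + d₂ = 1 + d₂) :
    ((∀ᶠ w in 𝓝 𝒮.identity, DifferentiableAt ℝ (𝒮.energy V) w) ∧
      DifferentiableAt ℝ (fderiv ℝ (𝒮.energy V)) 𝒮.identity) ∧
    ObjStr.BoundedWrt (fun u v => 𝒮.energyHess V u v) (𝒮.seminorm00 R) ∧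
    ∃ r : ℝ, 𝒮.lambda00 R V = (r : EReal) := by
  have hd' : d₁ = 1 := by omega
  have hB := ObjStr.ObjectiveStructure.boundedWrt_energyHess hd' hV hR
  exact ⟨⟨ObjStr.ObjectiveStructure.eventually_differentiableAt_energy hV,
    ObjStr.ObjectiveStructure.differentiableAt_fderiv_energy hV⟩, hB,
    hB.exists_sSup_eq (ObjStr.ObjectiveStructure.exists_seminorm00_pos hd' hG hR)⟩
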